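/- Let $M$ be a (connected) Riemann surface, let $n,r\ge 1$ be integers, let $\phi_0\in \mathrm{U}(n)$ (regarded as a constant map $M\to \mathrm U(n)$), and let $\alpha_1,\dots,\alpha_r$ be smooth subbundles of the trivial bundle $M\times\mathbb{C}^n$. Write $\pi_i$ and $\pi_i^\perp=I-\pi_i$ for the orthogonal projections onto $\alpha_i$ and onto its orthogonal complement, and put $$\phi_i=\phi_0(\pi_1-\pi_1^\perp)\cdots(\pi_i-\pi_i^\perp)\quad(0\le i\le r).$$ For a smooth map $\phi:M\to\mathrm U(n)$ and a local complex coordinate $z$ set $A^\phi_z=\tfrac12\phi^{-1}\partial_z\phi$, $A^\phi_{\bar z}=\tfrac12\phi^{-1}\partial_{\bar z}\phi$ and $D^\phi_{\bar z}=\partial_{\bar z}+A^\phi_{\bar z}$; $\phi$ is harmonic if and only if $\partial_{\bar z}A^\phi_z+[A^\phi_{\bar z},A^\phi_z]=0$. A smooth subbundle $\alpha$ is a *uniton* for $\phi$ if $\phi$ is harmonic and $D^\phi_{\bar z}\sigma$ and $A^\phi_z\sigma$ lie in $\alpha$ for every smooth section $\sigma$ of $\alpha$. The bundles $\alpha_1,\dots,\alpha_r$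 form a *sequence of unitons* if $\alpha_\ell$ is a uniton for $\phi_{\ell-1}$ for $\ell=1,\dots,r$. They satisfy the *covering condition* if $$\pi_{\ell-1}\alpha_\ell=\alpha_{\ell-1}\qquad(\ell=2,\dots,r),$$ where image bundles and spans are understood, here and below, as subbundles over all of $M$ obtained by extension over a closed discrete set; that is, an equality of this kind means equality of the fibres at all points off some closed discrete subset of $M$. For $0\le s\le i$ let $C^i_s=\sum_{1\le i_1<\dots<i_s\le i}\pi^\perp_{i_s}\cdots\pi^\perp_{i_1}$ (with $C^i_0=I$). Fix a choice of a local complex coordinate around each point of $M$, and let $H^{(k)}$ denote the $k$-th derivative of $H$ with respect to it. Then the following are equivalent: 1. $\alpha_1,\dots,\alpha_r$ is a sequence of unitons satisfying the covering condition. 2. There is an array $(H_{i,j})_{0\le i\le r-1,\;1\le j\le n}$ of $\mathbb{C}^n$-valued meromorphic functions on $M$ such that, for each $i=0,\dots,r-1$, $$\alpha_{i+1}=\mathrm{span}\Bigl\{\sum_{s=k}^{i}C^i_sH^{(k)}_{s-k,j}\;:\;1\le j\le n,\ 0\le k\le i\Bigr\}.$$ 3. There is a holomorphic subbundle $B$ of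 the trivial holomorphic bundle $M\times\mathbb{C}^{rn}$, $\mathbb{C}^{rn}=(\mathbb{C}^n)^r$, such that, for each $i=0,\dots,r-1$, $$\alpha_{i+1}=\sum_{k=0}^{i}\alpha_{i+1}^{(k)},\qquad \alpha_{i+1}^{(k)}=\mathrm{span}\Bigl\{\sum_{s=k}^{i}C^i_sH^{(k)}_{s-k}\;:\;H=(H_0,\dots,H_{r-1})\text{ a meromorphic section of }B\Bigr\}.$$ (At a given point only sections $H$ without a pole there are used.) -/

import Mathlib

open scoped Manifold ContDiff

noncomputable section

namespace CoveringUnitons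

/-- The fibre `ℂⁿ` with its standard Hermitian inner product. -/
abbrev Cn (n : ℕ) : Type := EuclideanSpace ℂ (Fin n)

/-- The endomorphisms of `ℂⁿ`. -/
abbrev EndC (n : ℕ) : Type := Cn n →L[ℂ] Cn n

/-- The unitary group `U(n)`. -/
abbrev Un (n : ℕ) : Type := unitary (EndC n)

/-- The fibre `ℂ^{rn}`, as the orthogonal direct sum of `r` copies of `ℂⁿ`. -/
abbrev Crn (r n : ℕ) : Type := PiLp 2 (fun _ : Fin r => Cn n)

section Calculus

variable {M : Type*} [TopologicalSpace M] [ChartedSpace ℂ M]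
variable {F : Type*} [NormedAddCommGroup F] [NormedSpace ℂ F]

/-- `e` is a local complex coordinate of the Riemann surface `M` defined near `p`. -/
def IsCoordAt (e : OpenPartialHomeomorph M ℂ) (p : M) : Prop :=
  e ∈ IsManifold.maximalAtlas 𝓘(ℂ) ω M ∧ p ∈ e.source

/-- Smoothness in the real sense (`C^∞` on the underlying real surface). -/
def IsSmooth (f : M → F) : Prop :=
  ContMDiff 𝓘(ℝ, ℂ) 𝓘(ℝ, F) ∞ f

/-- `∂f/∂z = (∂f/∂x - i ∂f/∂y) / 2` at `p`, in the local coordinate `e = x + i y`. -/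
def dz (e : OpenPartialHomeomorph M ℂ) (f : M → F) (p : M) : F :=
  (1 / 2 : ℂ) • (fderiv ℝ (f ∘ e.symm) (e p) 1
    - Complex.I • fderiv ℝ (f ∘ e.symm) (e p) Complex.I)

/-- `∂f/∂z̄ = (∂f/∂x + i ∂f/∂y) / 2` at `p`, in the local coordinate `e = x + i y`. -/
def dzbar (e : OpenPartialHomeomorph M ℂ) (f : M → F) (p : M) : F :=
  (1 / 2 : ℂ) • (fderiv ℝ (f ∘ e.symm) (e p) 1
    + Complex.I • fderiv ℝ (f ∘ e.symm) (e p) Complex.I)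

/-- Meromorphic `F`-valued functions on `M`. As in Mathlib, the values at the poles (or at other
isolated points) are immaterial. -/
def IsMeromorphic (f : M → F) : Prop :=
  ∀ (e : OpenPartialHomeomorph M ℂ) (p : M), IsCoordAt e p → MeromorphicAt (f ∘ e.symm) (e p)

/-- `f` is holomorphic near the point `p` of the domain of the coordinate `e`. -/
def IsRegularAt (e : OpenPartialHomeomorph M ℂ) (f : M → F) (p : M) : Prop :=
  AnalyticAt ℂ (f ∘ e.symm) (e p)

/-- The `k`-th complex derivative `f^{(k)}` at `p` with respect to the local coordinate `e`. -/
def cderiv (e : OpenPartialHomeomorph M ℂ) (k : ℕ) (f : M → F) (p : M) : F :=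
  iteratedDeriv k (f ∘ e.symm) (e p)

end Calculus

section Bundles

variable (M : Type*) [TopologicalSpace M] [ChartedSpace ℂ M]
variable (F : Type*) [NormedAddCommGroup F] [InnerProductSpace ℂ F] [FiniteDimensional ℂ F]

/-- A smooth subbundle of the trivial bundle `M × F`: a family of subspaces which is a smooth map
into the Grassmannian of `F`, i.e. whose orthogonal projections depend smoothly on the point. -/
structure Subbundle where
  fiber : M → Submodule ℂ F
  smooth : IsSmooth (fun p => (fiber p).starProjection)

end Bundles

namespace Subbundle

variable {M : Type*} [TopologicalSpace M] [ChartedSpace ℂ M]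
variable {F : Type*} [NormedAddCommGroup F] [InnerProductSpace ℂ F] [FiniteDimensional ℂ F]

/-- The orthogonal projection `π_α` onto `α`, at `p`. -/
def proj (α : Subbundle M F) (p : M) : F →L[ℂ] F := (α.fiber p).starProjection

/-- The orthogonal projection `π_α^⊥` onto the orthogonal complement of `α`, at `p`. -/
def projPerp (α : Subbundle M F) (p : M) : F →L[ℂ] F := ((α.fiber p)ᗮ).starProjection

/-- `σ` is a smooth section of `α`. -/
def IsSection (α : Subbundle M F) (σ : M → F) : Prop :=
  IsSmooth σ ∧ ∀ p, σ p ∈ α.fiber p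

/-- `α` is a holomorphic subbundle of the trivial holomorphic bundle `(M × F, ∂_z̄)`. -/
def IsHolomorphic (α : Subbundle M F) : Prop :=
  ∀ σ : M → F, α.IsSection σ →
    ∀ (e : OpenPartialHomeomorph M ℂ) (p : M), IsCoordAt e p → dzbar e σ p ∈ α.fiber p

/-- `H` is a meromorphic section of the subbundle `α` of the trivial holomorphic bundle. -/
def IsMeromorphicSection (α : Subbundle M F) (H : M → F) : Prop :=
  IsMeromorphic H ∧ ∀ᶠ p in Filter.codiscrete M, H p ∈ α.fiber p

end Subbundle

section Unitons

variable {M : Type*} [TopologicalSpace M] [ChartedSpace ℂ M] {n : ℕ}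

lemma projPerp_eq (α : Subbundle M (Cn n)) (p : M) : α.projPerp p = 1 - α.proj p :=
  Submodule.starProjection_orthogonal' _

lemma cartan_mem (α : Subbundle M (Cn n)) (p : M) :
    α.proj p - α.projPerp p ∈ unitary (EndC n) := by
  have hs : star (α.proj p) = α.proj p := (isSelfAdjoint_starProjection (α.fiber p)).star_eq
  have hi : α.proj p * α.proj p = α.proj p :=
    Submodule.isIdempotentElem_starProjection (α.fiber p)
  have key : (α.proj p - (1 - α.proj p)) * (α.proj p - (1 - α.proj p)) = 1 := by
    simp only [mul_sub, sub_mul, hi, one_mul, mul_one]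
    abel
  rw [projPerp_eq, Unitary.mem_iff]
  simp only [star_sub, star_one, hs]
  exact ⟨key, key⟩

/-- The map `π_α - π_α^⊥ : M → U(n)`. -/
def cartan (α : Subbundle M (Cn n)) (p : M) : Un n :=
  ⟨α.proj p - α.projPerp p, cartan_mem α p⟩

/-- `A^φ_z = (1/2) φ⁻¹ ∂_z φ` in the local coordinate `e`. -/
def Az (e : OpenPartialHomeomorph M ℂ) (φ : M → Un n) (p : M) : EndC n :=
  (1 / 2 : ℂ) • (((φ p)⁻¹ : Un n) * dz e (fun q => (φ q : EndC n)) p)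

/-- `A^φ_z̄ = (1/2) φ⁻¹ ∂_z̄ φ` in the local coordinate `e`. -/
def Azbar (e : OpenPartialHomeomorph M ℂ) (φ : M → Un n) (p : M) : EndC n :=
  (1 / 2 : ℂ) • (((φ p)⁻¹ : Un n) * dzbar e (fun q => (φ q : EndC n)) p)

/-- The operator `D^φ_z̄ = ∂_z̄ + A^φ_z̄` on sections of the trivial bundle `M × ℂⁿ`. -/
def Dzbar (e : OpenPartialHomeomorph M ℂ) (φ : M → Un n) (σ : M → Cn n) (p : M) : Cn n :=
  dzbar e σ p + Azbar e φ p (σ p)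

/-- A smooth map `φ : M → U(n)` is harmonic if `∂_z̄ A_z + [A_z̄, A_z] = 0` in all local
coordinates. This is the vanishing of the tension field, since `A_z` represents `∂φ/∂z` and
`d + A` is the pull-back of the Levi-Civita connection; equivalently, `A_z` commutes
with `D_z̄`. -/
structure IsHarmonic (φ : M → Un n) : Prop where
  smooth : IsSmooth (fun p => (φ p : EndC n))
  equation : ∀ (e : OpenPartialHomeomorph M ℂ) (p : M), IsCoordAt e p →
    dzbar e (Az e φ) p + (Azbar e φ p * Az e φ p - Az e φ p * Azbar e φ p) = 0

/-- `α` is a uniton for the harmonic map `φ`. -/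
structure IsUniton (φ : M → Un n) (α : Subbundle M (Cn n)) : Prop where
  harmonic : IsHarmonic φ
  holomorphic : ∀ σ : M → Cn n, α.IsSection σ →
    ∀ (e : OpenPartialHomeomorph M ℂ) (p : M), IsCoordAt e p → Dzbar e φ σ p ∈ α.fiber p
  closed : ∀ σ : M → Cn n, α.IsSection σ →
    ∀ (e : OpenPartialHomeomorph M ℂ) (p : M), IsCoordAt e p → Az e φ p (σ p) ∈ α.fiber p

/-- `φ_i = φ₀ (π_1 - π_1^⊥) ⋯ (π_i - π_i^⊥)`. -/
def phi (φ₀ : Un n) (α : ℕ → Subbundle M (Cn n)) : ℕ → M → Un n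
  | 0 => fun _ => φ₀
  | i + 1 => fun p => phi φ₀ α i p * cartan (α (i + 1)) p

/-- `α_1, …, α_r` is a sequence of unitons: `α_ℓ` is a uniton for `φ_{ℓ-1}`. -/
def IsUnitonSequence (φ₀ : Un n) (α : ℕ → Subbundle M (Cn n)) (r : ℕ) : Prop :=
  ∀ ℓ, 1 ≤ ℓ → ℓ ≤ r → IsUniton (phi φ₀ α (ℓ - 1)) (α ℓ)

/-- The covering condition `π_{ℓ-1} α_ℓ = α_{ℓ-1}` for `ℓ = 2, …, r`. Here `π_{ℓ-1} α_ℓ` is the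
image bundle of a bundle map whose rank may drop on a discrete set, over which the image is
extended; so the condition is that the fibres agree off a closed discrete set. -/
def Covering (α : ℕ → Subbundle M (Cn n)) (r : ℕ) : Prop :=
  ∀ ℓ, 2 ≤ ℓ → ℓ ≤ r → ∀ᶠ p in Filter.codiscrete M,
    ((α ℓ).fiber p).map ((α (ℓ - 1)).proj p : Cn n →ₗ[ℂ] Cn n) = (α (ℓ - 1)).fiber p

/-- The elementary function `C^i_s = ∑_{1 ≤ i_1 < ⋯ < i_s ≤ i} π_{i_s}^⊥ ⋯ π_{i_1}^⊥`, at `p`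
(the indices of each product are in decreasing order from left to right). -/
def C (α : ℕ → Subbundle M (Cn n)) (i s : ℕ) (p : M) : EndC n :=
  ∑ S ∈ (Finset.Icc 1 i).powersetCard s,
    ((S.sort (fun a b => b ≤ a)).map (fun l => (α l).projPerp p)).prod

/-- `K^{(k)}_i = ∑_{s=k}^{i} C^i_s H_{s-k}^{(k)}` at `p`, for a column `H_0, H_1, …` of
vector-valued functions, with derivatives taken in the local coordinate `e`. -/
def K (α : ℕ → Subbundle M (Cn n)) (e : OpenPartialHomeomorph M ℂ) (H : ℕ → M → Cn n)
    (i k : ℕ) (p : M) : Cn n :=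
  ∑ s ∈ Finset.Icc k i, C α i s p (cderiv e k (H (s - k)) p)

/-- `α_1, …, α_r` are given by the array `H = (H_{i,j})`, `0 ≤ i ≤ r-1`, `1 ≤ j ≤ n`: for each
`i = 0, …, r-1`, `α_{i+1}` is the subbundle spanned by the `K^{(k)}_{i,j}`, i.e. the fibres are
spanned by their values off a closed discrete set. At each point `p`,
derivatives are taken in the local coordinate `z p`. -/
def GivenByArray (z : M → OpenPartialHomeomorph M ℂ) (α : ℕ → Subbundle M (Cn n)) (r : ℕ)
    (H : ℕ → Fin n → M → Cn n) : Prop :=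
  ∀ i < r, ∀ᶠ p in Filter.codiscrete M, (α (i + 1)).fiber p =
    Submodule.span ℂ {v | ∃ (j : Fin n) (k : ℕ), k ≤ i ∧ v = K α (z p) (fun t => H t j) i k p}

/-- The components `H_0, …, H_{r-1}` of a function `H` with values in `ℂ^{rn}` (and zero for the
indices `t ≥ r`, which are never used). -/
def comp {r : ℕ} (H : M → Crn r n) (t : ℕ) (p : M) : Cn n :=
  if h : t < r then H p ⟨t, h⟩ else 0

/-- `α_1, …, α_r` are given by the holomorphic subbundle `B` of `M × ℂ^{rn}`: for each
`i = 0, …, r-1`, `α_{i+1} = ∑_{k=0}^{i} α_{i+1}^{(k)}`, where `α_{i+1}^{(k)}` is spanned by the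
`K^{(k)}_i` formed from the meromorphic sections `H` of `B`. This is required off a closed discrete
set, at each point of which only sections without a pole there are used. -/
def GivenByBundle (z : M → OpenPartialHomeomorph M ℂ) (α : ℕ → Subbundle M (Cn n)) (r : ℕ)
    (B : Subbundle M (Crn r n)) : Prop :=
  ∀ i < r, ∀ᶠ p in Filter.codiscrete M, (α (i + 1)).fiber p =
    ⨆ k ∈ Finset.range (i + 1), Submodule.span ℂ {v | ∃ H : M → Crn r n,
      B.IsMeromorphicSection H ∧ IsRegularAt (z p) H p ∧ v = K α (z p) (comp H) i k p}

end Unitons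

end CoveringUnitons

end

/-!
Write `π_i` and `π_i^⊥` for the projections belonging to `α_i`, and, for `x = (x_0, …, x_{r-1}) ∈
ℂ^{rn}`, put `E^i_m x = ∑_s C^i_{s+m} x_s` (`Csum α r i m`). Then `K^{(k)}_i = E^i_k (H^{(k)})`, and
both conditions on generators take one form: the bundles are spanned by the `K^{(k)}_i` of a set of
functions `H : M → ℂ^{rn}` (`IsGeneratedBy`).

The uniton conditions are tensorial: `π^⊥ A_z π = 0` and `(π^⊥ A_z̄ - ∂_z̄ π^⊥) π = 0`. With their
adjoints they show that adding the uniton `α_{i+1}` changes `A_z` into `A_z + ∂_z π^⊥` and `A_z̄`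
into `A_z̄ - ∂_z̄ π^⊥`, and preserves harmonicity (`isHarmonic_phi`). By induction on `i` this
gives, for `φ_i`, `∂_z C^i_{s+1} = A_z C^i_s` (`wirt_C`) and `∂_z̄ C^i_{s+1} + ∂_z̄ C^i_s = -A_z̄
C^i_s` (`wirt_C_add`).

From generators to unitons. If all `K^{(k)}_j` with `j < i` lie in `α_{j+1}`, then `E^i_{k+1}
(H^{(k)}) = 0`, because it is the sum of the `π_{j+1}^⊥ K^{(k)}_j`. So the two formulas give `D_z̄
K^{(k)}_i = 0` and `A_z K^{(k)}_i = -K^{(k+1)}_i`, so `α_{i+1}` is a uniton for `φ_i` at generic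
points, and everywhere by continuity (`IsGeneratedBy.isUnitonSequence`). The covering condition
holds since `π_i K^{(k)}_i = K^{(k)}_{i-1}` (`IsGeneratedBy.covering`). The same vanishing shows
that the choice of the coordinate only changes `K^{(k)}_i` by a factor (`IsAdapted.exists_coord`).

From unitons to generators. Let `B_p` consist of the `x` with `E^j_0 x ∈ α_{j+1}` at `p` for all `j
< r` (`kernelBundle`). The normal components of the `E^j_0` are jointly surjective at every point,
so `B` is a smooth bundle; by the formula for `∂_z̄ C` it is holomorphic, and all `K^{(k)}_j` formed
from its meromorphic sections lie in `α_{j+1}` (`IsMeromorphicSection.isAdapted`). Moreover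
`E^{r-1}_0` maps `B` onto `α_r` (`exists_Csum_eq`), and the covering condition then gives the lower
bundles, so it remains to find `n` meromorphic sections whose images under `E^{r-1}_0` span `α_r`
generically (`exists_meromorphicSections`).

No existence theorem for sections of bundles is needed for this, as `B` sits in a trivial bundle:
for fixed `b`, the projection onto `B_p` along the constant subspace `B_b^⊥` is holomorphic in `p`
near `b`, and the identity theorem for the determinant which decides its existence makes it
meromorphic on the connected surface `M` (`Subbundle.IsHolomorphic.isMeromorphic_skewProjection`).
Applied to vectors of `B_b` it yields meromorphic sections of `B`. Let `B'` be the bundle belonging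
to `α_1, …, α_{r-1}, 0`, which is the kernel of `E^{r-1}_0` on `B`. The map `E^{r-1}_0` is injective
on `B_b ∩ (B'_b)^⊥`, whose dimension is therefore at most `n`; a spanning family of this space gives
the `n` sections.
-/

open Filter Topology

noncomputable section

namespace CoveringUnitons

/-! ### Coordinates and the codiscrete filter -/

section Coordinates

variable {M : Type*} [TopologicalSpace M]

lemma eventually_codiscrete_iff {P : M → Prop} :
    (∀ᶠ p in codiscrete M, P p) ↔ ∀ p, ∀ᶠ q in 𝓝[≠] p, P q := by
  change {p | P p} ∈ codiscrete M ↔ _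
  rw [codiscrete, mem_codiscreteWithin_iff_forall_mem_nhdsNE]
  simp only [Set.mem_univ, forall_true_left, Set.compl_univ, Set.union_empty]
  rfl

/-- A codiscrete property holds on an open codiscrete set. -/
lemma eventually_codiscrete_nhds {P : M → Prop} (h : ∀ᶠ p in codiscrete M, P p) :
    ∀ᶠ p in codiscrete M, ∀ᶠ q in 𝓝 p, P q := by
  have ho : IsOpen {p | P p} := (mem_codiscrete'.1 h).1
  filter_upwards [h] with p hp using ho.mem_nhds hp

variable [ChartedSpace ℂ M] {F : Type*} [NormedAddCommGroup F] [NormedSpace ℂ F]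
  {e e' : OpenPartialHomeomorph M ℂ} {p : M}

lemma IsCoordAt.eventually (h : IsCoordAt e p) : ∀ᶠ q in 𝓝 p, IsCoordAt e q := by
  filter_upwards [e.open_source.mem_nhds h.2] with q hq using ⟨h.1, hq⟩

lemma isCoordAt_chartAt [IsManifold 𝓘(ℂ) ω M] (p : M) : IsCoordAt (chartAt ℂ p) p :=
  ⟨IsManifold.chart_mem_maximalAtlas p, mem_chart_source ℂ p⟩

lemma IsCoordAt.tendsto_symm (h : IsCoordAt e p) : Tendsto e.symm (𝓝 (e p)) (𝓝 p) :=
  e.tendsto_symm h.2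

lemma IsCoordAt.tendsto_nhdsNE (h : IsCoordAt e p) : Tendsto e (𝓝[≠] p) (𝓝[≠] (e p)) := by
  refine tendsto_nhdsWithin_iff.2
    ⟨(e.continuousAt h.2).tendsto.mono_left nhdsWithin_le_nhds, ?_⟩
  filter_upwards [nhdsWithin_le_nhds (e.open_source.mem_nhds h.2), self_mem_nhdsWithin]
    with q hq hqp he
  exact hqp (e.injOn hq h.2 he)

lemma IsCoordAt.tendsto_symm_nhdsNE (h : IsCoordAt e p) :
    Tendsto e.symm (𝓝[≠] (e p)) (𝓝[≠] p) := by
  refine tendsto_nhdsWithin_iff.2 ⟨h.tendsto_symm.mono_left nhdsWithin_le_nhds, ?_⟩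
  filter_upwards [nhdsWithin_le_nhds (e.open_target.mem_nhds (e.map_source h.2)),
    self_mem_nhdsWithin] with w hw hwp he
  exact hwp (by rw [← e.right_inv hw, Set.mem_singleton_iff.1 he]; rfl)

lemma IsCoordAt.eventually_left_inv (h : IsCoordAt e p) : ∀ᶠ q in 𝓝 p, e.symm (e q) = q := by
  filter_upwards [e.open_source.mem_nhds h.2] with q hq using e.left_inv hq

lemma IsCoordAt.eventually_right_inv (h : IsCoordAt e p) :
    ∀ᶠ w in 𝓝 (e p), e (e.symm w) = w := by
  filter_upwards [e.open_target.mem_nhds (e.map_source h.2)] with w hw using e.right_inv hw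

lemma IsCoordAt.left_inv (h : IsCoordAt e p) : e.symm (e p) = p := e.left_inv h.2

/-- A point of a Riemann surface is not isolated. -/
lemma IsCoordAt.neBot (h : IsCoordAt e p) : (𝓝[≠] p).NeBot :=
  h.tendsto_symm_nhdsNE.neBot

lemma analyticAt_transition [IsManifold 𝓘(ℂ) ω M] (h : IsCoordAt e p) (h' : IsCoordAt e' p) :
    AnalyticAt ℂ (e' ∘ e.symm) (e p) := by
  have hc := StructureGroupoid.compatible_of_mem_maximalAtlas h.1 h'.1
  rw [contDiffGroupoid, mem_groupoid_of_pregroupoid] at hc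
  have h1 : ContDiffOn ℂ ω (e' ∘ e.symm) (e.symm ≫ₕ e').source := by
    simpa [contDiffPregroupoid] using hc.1
  have hmem : e p ∈ (e.symm ≫ₕ e').source := by
    simp [e.map_source h.2, h.left_inv, h'.2]
  exact (h1.contDiffAt ((e.symm ≫ₕ e').open_source.mem_nhds hmem)).analyticAt

lemma eventuallyEq_transition (h : IsCoordAt e p) (h' : IsCoordAt e' p) {X : Type*} (f : M → X) :
    f ∘ e.symm =ᶠ[𝓝 (e p)] (f ∘ e'.symm) ∘ (e' ∘ e.symm) := by
  filter_upwards [h.tendsto_symm.eventually h'.eventually_left_inv] with w hw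
  simp [hw]

lemma IsRegularAt.congr_coord [IsManifold 𝓘(ℂ) ω M] (h : IsCoordAt e p) (h' : IsCoordAt e' p)
    {f : M → F} (hf : IsRegularAt e f p) : IsRegularAt e' f p := by
  refine AnalyticAt.congr ?_ (eventuallyEq_transition h' h f).symm
  refine AnalyticAt.comp ?_ (analyticAt_transition h' h)
  simpa [IsRegularAt, h'.left_inv] using hf

lemma IsRegularAt.eventually [CompleteSpace F] (h : IsCoordAt e p) {f : M → F}
    (hf : IsRegularAt e f p) : ∀ᶠ q in 𝓝 p, IsRegularAt e f q :=
  (e.continuousAt h.2).eventually (isOpen_analyticAt ℂ _ |>.mem_nhds hf)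

lemma IsMeromorphic.eventually_isRegularAt [IsManifold 𝓘(ℂ) ω M] [CompleteSpace F]
    {z : M → OpenPartialHomeomorph M ℂ} (hz : ∀ p, IsCoordAt (z p) p) {f : M → F}
    (hf : IsMeromorphic f) : ∀ᶠ p in codiscrete M, IsRegularAt (z p) f p := by
  refine eventually_codiscrete_iff.2 fun p => ?_
  have h1 := (hz p).tendsto_nhdsNE.eventually (hf (z p) p (hz p)).eventually_analyticAt
  filter_upwards [h1, nhdsWithin_le_nhds (hz p).eventually] with q hq hq'
  exact IsRegularAt.congr_coord hq' (hz q) hq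

/-- Meromorphy may be tested in one coordinate around each point. -/
lemma isMeromorphic_of_forall_exists [IsManifold 𝓘(ℂ) ω M] {f : M → F}
    (hf : ∀ p, ∃ e, IsCoordAt e p ∧ MeromorphicAt (f ∘ e.symm) (e p)) : IsMeromorphic f := by
  intro e p h
  obtain ⟨e', h', hf'⟩ := hf p
  have h1 : AnalyticAt ℂ (e' ∘ e.symm) (e p) := analyticAt_transition h h'
  have h2 : MeromorphicAt (f ∘ e'.symm) ((e' ∘ e.symm) (e p)) := by simpa [h.left_inv] using hf'
  exact (h2.comp_analyticAt h1).congr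
    (nhdsWithin_le_nhds (eventuallyEq_transition h h' f).symm)

/-- The higher chain rule, in qualitative form: `(f ∘ ψ)^{(k)}` is a combination of
`f ∘ ψ, …, f^{(k)} ∘ ψ` with analytic coefficients. -/
lemma exists_iteratedDeriv_comp [CompleteSpace F] {f : ℂ → F} {ψ : ℂ → ℂ} {w : ℂ}
    (hψ : AnalyticAt ℂ ψ w) (hf : AnalyticAt ℂ f (ψ w)) (k : ℕ) :
    ∃ c : ℕ → ℂ → ℂ, (∀ m, AnalyticAt ℂ (c m) w) ∧ (∀ m, k < m → c m = 0) ∧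
      ∀ᶠ v in 𝓝 w, iteratedDeriv k (f ∘ ψ) v =
        ∑ m ∈ Finset.range (k + 1), c m v • iteratedDeriv m f (ψ v) := by
  induction k with
  | zero =>
    refine ⟨fun m _ => if m = 0 then 1 else 0, fun m => ?_, fun m hm => ?_, ?_⟩
    · exact analyticAt_const
    · funext v; simp [hm.ne']
    · simp
  | succ k ih =>
    obtain ⟨c, hc, hc0, hk⟩ := ih
    have hf' : ∀ m, ∀ᶠ v in 𝓝 w, AnalyticAt ℂ (iteratedDeriv m f) (ψ v) := fun m =>
      hψ.continuousAt.eventually (hf.eventually_analyticAt.mono fun _ h => by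
        rw [iteratedDeriv_eq_iterate]; exact h.iterated_deriv m)
    refine ⟨fun m v => deriv (c m) v + (if m = 0 then 0 else c (m - 1) v) * deriv ψ v,
      fun m => ?_, fun m hm => ?_, ?_⟩
    · refine (hc m).deriv.add (AnalyticAt.mul ?_ hψ.deriv)
      split_ifs
      exacts [analyticAt_const, hc _]
    · funext v
      simp [hc0 m (by omega), hc0 (m - 1) (by omega)]
    · have hfin : ∀ᶠ v in 𝓝 w, ∀ m ∈ Finset.range (k + 1),
          AnalyticAt ℂ (c m) v ∧ AnalyticAt ℂ (iteratedDeriv m f) (ψ v) :=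
        (Finset.eventually_all _).2 fun m _ => (hc m).eventually_analyticAt.and (hf' m)
      filter_upwards [hk.eventually_nhds, hfin, hψ.eventually_analyticAt] with v hv hfv hψv
      rw [iteratedDeriv_succ, EventuallyEq.deriv_eq hv]
      have hd : ∀ m ∈ Finset.range (k + 1),
          HasDerivAt (fun v => c m v • iteratedDeriv m f (ψ v))
            (c m v • (deriv ψ v • iteratedDeriv (m + 1) f (ψ v)) +
              deriv (c m) v • iteratedDeriv m f (ψ v)) v := by
        intro m hm
        have h2 := (hfv m hm).2.differentiableAt.hasDerivAt
        rw [← iteratedDeriv_succ] at h2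
        exact (hfv m hm).1.differentiableAt.hasDerivAt.smul
          (h2.scomp v hψv.differentiableAt.hasDerivAt)
      rw [(HasDerivAt.fun_sum hd).deriv, Finset.sum_add_distrib, add_comm]
      simp only [add_smul, Finset.sum_add_distrib]
      congr 1
      · rw [Finset.sum_range_succ _ (k + 1), hc0 (k + 1) (by omega)]
        simp
      · rw [Finset.sum_range_succ' _ (k + 1)]
        simp [smul_smul]

/-- Derivatives with respect to two coordinates are related by scalar coefficients. -/
lemma exists_cderiv_coord [IsManifold 𝓘(ℂ) ω M] [CompleteSpace F] (h : IsCoordAt e p)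
    (h' : IsCoordAt e' p) {f : M → F} (hf : IsRegularAt e f p) (k : ℕ) :
    ∃ c : ℕ → ℂ, cderiv e' k f p = ∑ m ∈ Finset.range (k + 1), c m • cderiv e m f p := by
  have h1 := analyticAt_transition h' h
  have h2 : AnalyticAt ℂ (f ∘ e.symm) ((e ∘ e'.symm) (e' p)) := by
    simpa [IsRegularAt, h'.left_inv] using hf
  obtain ⟨c, -, -, hc⟩ := exists_iteratedDeriv_comp h1 h2 k
  refine ⟨fun m => c m (e' p), ?_⟩
  have h3 := hc.self_of_nhds
  rw [← (eventuallyEq_transition h' h f).iteratedDeriv_eq k] at h3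
  simpa [cderiv, h'.left_inv] using h3

end Coordinates

/-! ### Smoothness and Wirtinger derivatives -/

section Wirtinger

set_option linter.unusedSectionVars false

variable {M : Type*} [TopologicalSpace M] [ChartedSpace ℂ M]
variable {F : Type*} [NormedAddCommGroup F] [NormedSpace ℂ F]
variable {X : Type*} [NormedAddCommGroup X] [NormedSpace ℂ X]
variable {Y : Type*} [NormedAddCommGroup Y] [NormedSpace ℂ Y]
variable {A : Type*} [NormedRing A] [NormedAlgebra ℂ A]
variable {e e' : OpenPartialHomeomorph M ℂ} {p : M}

/-- `f` is smooth near `p`, tested in the coordinate `e`. -/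
def SmoothAt (e : OpenPartialHomeomorph M ℂ) (f : M → F) (p : M) : Prop :=
  ContDiffAt ℝ ∞ (f ∘ e.symm) (e p)

/-- The first-order operator `(∂_x + c ∂_y) / 2` in the coordinate `e = x + i y`. It is `∂_z` for
`c = -i` and `∂_z̄` for `c = i`, and is used to prove the rules of calculus for both at once. -/
def wirt (c : ℂ) (e : OpenPartialHomeomorph M ℂ) (f : M → F) (p : M) : F :=
  (1 / 2 : ℂ) • (fderiv ℝ (f ∘ e.symm) (e p) 1
    + c • fderiv ℝ (f ∘ e.symm) (e p) Complex.I)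

lemma dz_eq_wirt (f : M → F) : dz e f p = wirt (-Complex.I) e f p := by
  simp [dz, wirt, sub_eq_add_neg]

lemma dzbar_eq_wirt (f : M → F) : dzbar e f p = wirt Complex.I e f p := rfl

lemma SmoothAt.congr_coord [IsManifold 𝓘(ℂ) ω M] (h : IsCoordAt e p) (h' : IsCoordAt e' p)
    {f : M → F} (hf : SmoothAt e f p) : SmoothAt e' f p := by
  refine ContDiffAt.congr_of_eventuallyEq ?_ (eventuallyEq_transition h' h f)
  have h1 : ContDiffAt ℝ ∞ (e ∘ e'.symm) (e' p) :=
    (analyticAt_transition h' h).contDiffAt.restrict_scalars ℝ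
  refine ContDiffAt.comp _ ?_ h1
  simpa [SmoothAt, h'.left_inv] using hf

lemma isSmooth_of_forall_exists [IsManifold 𝓘(ℂ) ω M] {f : M → F}
    (hf : ∀ p, ∃ e, IsCoordAt e p ∧ SmoothAt e f p) : IsSmooth f := by
  intro p
  obtain ⟨e, h, hs⟩ := hf p
  have h0 := hs.congr_coord h (isCoordAt_chartAt p)
  refine contMDiffAt_iff.2 ⟨?_, ?_⟩
  · have h1 : ContinuousAt (f ∘ (chartAt ℂ p).symm) (chartAt ℂ p p) := ContDiffAt.continuousAt h0
    refine (h1.comp ((chartAt ℂ p).continuousAt (mem_chart_source ℂ p))).congr ?_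
    filter_upwards [(isCoordAt_chartAt p).eventually_left_inv] with q hq
    simp [hq]
  · rw [extChartAt_model_space_eq_id]
    simpa [extChartAt, SmoothAt, contDiffWithinAt_univ, Function.comp_def] using h0

lemma IsSmooth.smoothAt [IsManifold 𝓘(ℂ) ω M] {f : M → F} (hf : IsSmooth f)
    (h : IsCoordAt e p) : SmoothAt e f p := by
  refine SmoothAt.congr_coord (isCoordAt_chartAt p) h ?_
  have := (contMDiffAt_iff.1 (hf p)).2
  rw [extChartAt_model_space_eq_id] at this
  simpa [extChartAt, SmoothAt, contDiffWithinAt_univ, Function.comp_def] using this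

lemma isSmooth_iff [IsManifold 𝓘(ℂ) ω M] {f : M → F} :
    IsSmooth f ↔ ∀ e p, IsCoordAt e p → SmoothAt e f p :=
  ⟨fun hf _ _ h => hf.smoothAt h,
    fun hf => isSmooth_of_forall_exists fun p =>
      ⟨_, isCoordAt_chartAt p, hf _ _ (isCoordAt_chartAt p)⟩⟩

lemma comp_symm_eventuallyEq (h : IsCoordAt e p) {β : Type*} {f g : M → β} (hfg : f =ᶠ[𝓝 p] g) :
    f ∘ e.symm =ᶠ[𝓝 (e p)] g ∘ e.symm :=
  h.tendsto_symm.eventually hfg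

lemma SmoothAt.congr (h : IsCoordAt e p) {f g : M → F} (hf : SmoothAt e f p)
    (hfg : f =ᶠ[𝓝 p] g) : SmoothAt e g p :=
  ContDiffAt.congr_of_eventuallyEq hf (comp_symm_eventuallyEq h hfg).symm

lemma wirt_congr (h : IsCoordAt e p) {f g : M → F} (hfg : f =ᶠ[𝓝 p] g) (c : ℂ) :
    wirt c e f p = wirt c e g p := by
  simp only [wirt, (comp_symm_eventuallyEq h hfg).fderiv_eq]

lemma SmoothAt.differentiableAt {f : M → F} (hf : SmoothAt e f p) :
    DifferentiableAt ℝ (f ∘ e.symm) (e p) :=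
  ContDiffAt.differentiableAt hf (by simp)

lemma SmoothAt.continuousAt (h : IsCoordAt e p) {f : M → F} (hf : SmoothAt e f p) :
    ContinuousAt f p := by
  refine (ContinuousAt.comp (ContDiffAt.continuousAt hf) (e.continuousAt h.2)).congr ?_
  filter_upwards [h.eventually_left_inv] with q hq
  simp [hq]

/-- A smooth function vanishing on a punctured neighbourhood vanishes at the centre. -/
lemma SmoothAt.eq_zero_of_punctured (h : IsCoordAt e p) {f : M → F} (hf : SmoothAt e f p)
    (h0 : ∀ᶠ q in 𝓝[≠] p, f q = 0) : f p = 0 := by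
  have := h.neBot
  have h1 : Tendsto f (𝓝[≠] p) (𝓝 (f p)) := (hf.continuousAt h).tendsto.mono_left nhdsWithin_le_nhds
  exact tendsto_nhds_unique h1 (tendsto_const_nhds.congr' (h0.mono fun _ hq => hq.symm))

lemma SmoothAt.const (y : F) : SmoothAt e (fun _ => y) p := contDiffAt_const

lemma SmoothAt.add {f g : M → F} (hf : SmoothAt e f p) (hg : SmoothAt e g p) :
    SmoothAt e (fun q => f q + g q) p := ContDiffAt.add hf hg

lemma SmoothAt.sub {f g : M → F} (hf : SmoothAt e f p) (hg : SmoothAt e g p) :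
    SmoothAt e (fun q => f q - g q) p := ContDiffAt.sub hf hg

lemma SmoothAt.sum {ι : Type*} {s : Finset ι} {f : ι → M → F}
    (hf : ∀ i ∈ s, SmoothAt e (f i) p) : SmoothAt e (fun q => ∑ i ∈ s, f i q) p :=
  ContDiffAt.sum (f := fun i w => f i (e.symm w)) hf

lemma SmoothAt.clm (L : F →L[ℂ] X) {f : M → F} (hf : SmoothAt e f p) :
    SmoothAt e (fun q => L (f q)) p :=
  (L.restrictScalars ℝ).contDiff.contDiffAt.comp _ hf

lemma SmoothAt.bilin (B : F →L[ℂ] X →L[ℂ] Y) {f : M → F} {g : M → X} (hf : SmoothAt e f p)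
    (hg : SmoothAt e g p) : SmoothAt e (fun q => B (f q) (g q)) p := by
  have hB : ContDiff ℝ ∞ (fun x : F × X => B x.1 x.2) :=
    (B.isBoundedBilinearMap.contDiff (n := ∞)).restrict_scalars ℝ
  exact ContDiffAt.comp (e p) (f := fun w => (f (e.symm w), g (e.symm w))) hB.contDiffAt
    (ContDiffAt.prodMk hf hg)

lemma SmoothAt.const_smul (c : ℂ) {f : M → F} (hf : SmoothAt e f p) :
    SmoothAt e (fun q => c • f q) p := hf.clm (c • ContinuousLinearMap.id ℂ F)

lemma SmoothAt.mul {f g : M → A} (hf : SmoothAt e f p) (hg : SmoothAt e g p) :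
    SmoothAt e (fun q => f q * g q) p := hf.bilin (ContinuousLinearMap.mul ℂ A) hg

lemma SmoothAt.clm_apply {f : M → F →L[ℂ] X} {g : M → F} (hf : SmoothAt e f p)
    (hg : SmoothAt e g p) : SmoothAt e (fun q => f q (g q)) p :=
  hf.bilin (ContinuousLinearMap.id ℂ (F →L[ℂ] X)) hg

lemma SmoothAt.clm_comp {f : M → X →L[ℂ] Y} {g : M → F →L[ℂ] X} (hf : SmoothAt e f p)
    (hg : SmoothAt e g p) : SmoothAt e (fun q => f q ∘L g q) p :=
  hf.bilin (ContinuousLinearMap.compL ℂ F X Y) hg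

lemma SmoothAt.ringInverse [CompleteSpace A] {f : M → A} (h : IsCoordAt e p)
    (hf : SmoothAt e f p) (hu : IsUnit (f p)) : SmoothAt e (fun q => Ring.inverse (f q)) p := by
  obtain ⟨u, hu⟩ := hu
  refine ContDiffAt.comp (e p) (f := f ∘ e.symm) ?_ hf
  have : (f ∘ e.symm) (e p) = u := by simp [h.left_inv, hu]
  rw [this]
  exact contDiffAt_ringInverse ℝ u

lemma wirt_const (c : ℂ) (y : F) : wirt c e (fun _ : M => y) p = 0 := by
  have : (fun _ : M => y) ∘ e.symm = fun _ => y := rfl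
  simp [wirt, this]

lemma wirt_add (c : ℂ) {f g : M → F} (hf : SmoothAt e f p) (hg : SmoothAt e g p) :
    wirt c e (fun q => f q + g q) p = wirt c e f p + wirt c e g p := by
  have : (fun q => f q + g q) ∘ e.symm = f ∘ e.symm + g ∘ e.symm := rfl
  simp only [wirt, this, fderiv_add hf.differentiableAt hg.differentiableAt,
    add_apply]
  module

lemma wirt_sub (c : ℂ) {f g : M → F} (hf : SmoothAt e f p) (hg : SmoothAt e g p) :
    wirt c e (fun q => f q - g q) p = wirt c e f p - wirt c e g p := by
  have : (fun q => f q - g q) ∘ e.symm = f ∘ e.symm - g ∘ e.symm := rfl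
  simp only [wirt, this, fderiv_sub hf.differentiableAt hg.differentiableAt,
    sub_apply]
  module

lemma wirt_sum (c : ℂ) {ι : Type*} {s : Finset ι} {f : ι → M → F}
    (hf : ∀ i ∈ s, SmoothAt e (f i) p) :
    wirt c e (fun q => ∑ i ∈ s, f i q) p = ∑ i ∈ s, wirt c e (f i) p := by
  classical
  induction s using Finset.induction_on with
  | empty => simp [wirt_const]
  | insert a s ha ih =>
    have h1 : ∀ i ∈ s, SmoothAt e (f i) p := fun i hi => hf i (Finset.mem_insert_of_mem hi)
    simp only [Finset.sum_insert ha]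
    rw [wirt_add c (hf a (Finset.mem_insert_self a s)) (SmoothAt.sum h1), ih h1]

lemma wirt_clm (c : ℂ) (L : F →L[ℂ] X) {f : M → F} (hf : SmoothAt e f p) :
    wirt c e (fun q => L (f q)) p = L (wirt c e f p) := by
  have h1 : HasFDerivAt ((fun q => L (f q)) ∘ e.symm)
      ((L.restrictScalars ℝ) ∘L fderiv ℝ (f ∘ e.symm) (e p)) (e p) :=
    (L.restrictScalars ℝ).hasFDerivAt.comp (e p) hf.differentiableAt.hasFDerivAt
  simp [wirt, h1.fderiv]

lemma wirt_const_smul (c a : ℂ) {f : M → F} (hf : SmoothAt e f p) :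
    wirt c e (fun q => a • f q) p = a • wirt c e f p :=
  wirt_clm c (a • ContinuousLinearMap.id ℂ F) hf

lemma wirt_bilin (h : IsCoordAt e p) (c : ℂ) (B : F →L[ℂ] X →L[ℂ] Y) {f : M → F} {g : M → X}
    (hf : SmoothAt e f p) (hg : SmoothAt e g p) :
    wirt c e (fun q => B (f q) (g q)) p = B (wirt c e f p) (g p) + B (f p) (wirt c e g p) := by
  have hB : HasFDerivAt (fun x : F × X => B x.1 x.2) _ ((f ∘ e.symm) (e p), (g ∘ e.symm) (e p)) :=
    (B.isBoundedBilinearMap.hasFDerivAt _).restrictScalars ℝ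
  have h1 := hB.comp (e p)
    (hf.differentiableAt.hasFDerivAt.prodMk hg.differentiableAt.hasFDerivAt)
  have h2 : (fun q => B (f q) (g q)) ∘ e.symm = (fun x : F × X => B x.1 x.2) ∘
    fun w => ((f ∘ e.symm) w, (g ∘ e.symm) w) := rfl
  simp only [wirt, h2, h1.fderiv]
  simp only [ContinuousLinearMap.comp_apply, ContinuousLinearMap.prod_apply,
    ContinuousLinearMap.coe_restrictScalars', IsBoundedBilinearMap.deriv_apply,
    Function.comp_apply, h.left_inv, map_add, map_smul, add_apply,
    smul_apply]
  module

lemma wirt_mul (h : IsCoordAt e p) (c : ℂ) {f g : M → A} (hf : SmoothAt e f p)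
    (hg : SmoothAt e g p) :
    wirt c e (fun q => f q * g q) p = wirt c e f p * g p + f p * wirt c e g p :=
  wirt_bilin h c (ContinuousLinearMap.mul ℂ A) hf hg

lemma wirt_clm_apply (h : IsCoordAt e p) (c : ℂ) {f : M → F →L[ℂ] X} {g : M → F}
    (hf : SmoothAt e f p) (hg : SmoothAt e g p) :
    wirt c e (fun q => f q (g q)) p = wirt c e f p (g p) + f p (wirt c e g p) :=
  wirt_bilin h c (ContinuousLinearMap.id ℂ (F →L[ℂ] X)) hf hg

/-- In the coordinate, `wirt` is given by directional derivatives at all nearby points. -/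
lemma wirt_comp_symm_eventuallyEq (h : IsCoordAt e p) (c : ℂ) (f : M → F) :
    wirt c e f ∘ e.symm =ᶠ[𝓝 (e p)] fun w =>
      (1 / 2 : ℂ) • (fderiv ℝ (f ∘ e.symm) w 1 + c • fderiv ℝ (f ∘ e.symm) w Complex.I) := by
  filter_upwards [h.eventually_right_inv] with w hw
  simp [wirt, hw]

lemma SmoothAt.wirt (h : IsCoordAt e p) (c : ℂ) {f : M → F} (hf : SmoothAt e f p) :
    SmoothAt e (wirt c e f) p := by
  refine ContDiffAt.congr_of_eventuallyEq ?_ (wirt_comp_symm_eventuallyEq h c f)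
  have h1 : ContDiffAt ℝ ∞ (fderiv ℝ (f ∘ e.symm)) (e p) := ContDiffAt.fderiv_right hf (by simp)
  have h2 : ∀ v : ℂ, ContDiffAt ℝ ∞ (fun w => fderiv ℝ (f ∘ e.symm) w v) (e p) :=
    fun v => h1.clm_apply contDiffAt_const
  have h3 : ∀ a : ℂ, ContDiff ℝ ∞ (fun y : F => a • y) := fun a =>
    (((a • ContinuousLinearMap.id ℂ F : F →L[ℂ] F)).restrictScalars ℝ).contDiff
  exact (h3 _).contDiffAt.comp _ ((h2 1).add ((h3 c).contDiffAt.comp _ (h2 Complex.I)))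

lemma wirt_comm (h : IsCoordAt e p) (c d : ℂ) {f : M → F} (hf : SmoothAt e f p) :
    wirt c e (wirt d e f) p = wirt d e (wirt c e f) p := by
  have h1 : ContDiffAt ℝ ∞ (fderiv ℝ (f ∘ e.symm)) (e p) := ContDiffAt.fderiv_right hf (by simp)
  have h2 : DifferentiableAt ℝ (fderiv ℝ (f ∘ e.symm)) (e p) := h1.differentiableAt (by simp)
  have hsymm : IsSymmSndFDerivAt ℝ (f ∘ e.symm) (e p) :=
    ContDiffAt.isSymmSndFDerivAt hf (by
      rw [minSmoothness_of_isRCLikeNormedField]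
      exact WithTop.coe_le_coe.2 (le_top : (2 : ℕ∞) ≤ ⊤))
  have h3 : ∀ v : ℂ, HasFDerivAt (fun w => fderiv ℝ (f ∘ e.symm) w v)
      ((ContinuousLinearMap.apply ℝ F v) ∘L fderiv ℝ (fderiv ℝ (f ∘ e.symm)) (e p)) (e p) :=
    fun v => (ContinuousLinearMap.apply ℝ F v).hasFDerivAt.comp (e p) h2.hasFDerivAt
  have h4 : ∀ (a : ℂ) {g : ℂ → F} {g' : ℂ →L[ℝ] F}, HasFDerivAt g g' (e p) →
      HasFDerivAt (fun w => a • g w)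
        (((a • ContinuousLinearMap.id ℂ F : F →L[ℂ] F).restrictScalars ℝ) ∘L g') (e p) :=
    fun a g g' hg =>
      ((a • ContinuousLinearMap.id ℂ F : F →L[ℂ] F).restrictScalars ℝ).hasFDerivAt.comp (e p) hg
  have h5 : ∀ c : ℂ, ∀ v : ℂ, fderiv ℝ (wirt c e f ∘ e.symm) (e p) v =
      (1 / 2 : ℂ) • (fderiv ℝ (fderiv ℝ (f ∘ e.symm)) (e p) v 1 +
        c • fderiv ℝ (fderiv ℝ (f ∘ e.symm)) (e p) v Complex.I) := by
    intro c v
    have h6 : HasFDerivAt (fun w => (1 / 2 : ℂ) • (fderiv ℝ (f ∘ e.symm) w 1 +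
        c • fderiv ℝ (f ∘ e.symm) w Complex.I)) _ (e p) :=
      h4 (1 / 2) ((h3 1).add (h4 c (h3 Complex.I)))
    rw [(wirt_comp_symm_eventuallyEq h c f).fderiv_eq, h6.fderiv]
    simp
  rw [wirt, wirt, h5, h5, h5, h5, hsymm 1 Complex.I]
  module

lemma SmoothAt.of_isRegularAt [CompleteSpace F] {f : M → F} (hf : IsRegularAt e f p) :
    SmoothAt e f p :=
  (AnalyticAt.contDiffAt hf (n := ∞)).restrict_scalars ℝ

lemma wirt_of_isRegularAt {f : M → F} (hf : IsRegularAt e f p) (c : ℂ) :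
    wirt c e f p = ((1 + c * Complex.I) / 2) • cderiv e 1 f p := by
  have h1 : HasDerivAt (f ∘ e.symm) (cderiv e 1 f p) (e p) := by
    rw [cderiv, iteratedDeriv_one]
    exact (AnalyticAt.differentiableAt hf).hasDerivAt
  have h2 := h1.hasFDerivAt.restrictScalars ℝ
  simp only [wirt, h2.fderiv, ContinuousLinearMap.coe_restrictScalars',
    ContinuousLinearMap.toSpanSingleton_apply]
  module

lemma dzbar_of_isRegularAt {f : M → F} (hf : IsRegularAt e f p) : dzbar e f p = 0 := by
  rw [dzbar_eq_wirt, wirt_of_isRegularAt hf]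
  simp

lemma dz_of_isRegularAt {f : M → F} (hf : IsRegularAt e f p) :
    dz e f p = cderiv e 1 f p := by
  rw [dz_eq_wirt, wirt_of_isRegularAt hf]
  simp

/-- Smooth solutions of the Cauchy–Riemann equation are holomorphic. -/
lemma SmoothAt.isRegularAt [CompleteSpace F] (h : IsCoordAt e p) {f : M → F}
    (hf : ∀ᶠ q in 𝓝 p, SmoothAt e f q) (h0 : ∀ᶠ q in 𝓝 p, dzbar e f q = 0) : IsRegularAt e f p := by
  refine Complex.analyticAt_iff_eventually_differentiableAt.2 ?_
  filter_upwards [h.tendsto_symm.eventually hf, h.tendsto_symm.eventually h0,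
    h.eventually_right_inv] with w hw hw0 hr
  have hd := hw.differentiableAt
  rw [hr] at hd
  refine differentiableAt_complex_iff_differentiableAt_real.2 ⟨hd, ?_⟩
  have h2 : fderiv ℝ (f ∘ e.symm) w 1 + Complex.I • fderiv ℝ (f ∘ e.symm) w Complex.I = 0 := by
    rw [dzbar, hr] at hw0
    exact (smul_eq_zero.1 hw0).resolve_left (by norm_num)
  have h3 := congrArg (fun y => Complex.I • y) h2
  simp only [smul_add, smul_smul, Complex.I_mul_I, neg_smul, one_smul, smul_zero] at h3
  exact (add_neg_eq_zero.1 h3).symm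

lemma analyticAt_iteratedDeriv [CompleteSpace F] {f : ℂ → F} {w : ℂ} (hf : AnalyticAt ℂ f w)
    (k : ℕ) : AnalyticAt ℂ (iteratedDeriv k f) w := by
  rw [iteratedDeriv_eq_iterate]
  exact hf.iterated_deriv k

lemma cderiv_comp_symm_eventuallyEq (h : IsCoordAt e p) (f : M → F) (k : ℕ) :
    cderiv e k f ∘ e.symm =ᶠ[𝓝 (e p)] iteratedDeriv k (f ∘ e.symm) := by
  filter_upwards [h.eventually_right_inv] with w hw
  simp [cderiv, hw]

lemma IsRegularAt.cderiv [CompleteSpace F] (h : IsCoordAt e p) {f : M → F}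
    (hf : IsRegularAt e f p) (k : ℕ) : IsRegularAt e (cderiv e k f) p :=
  (analyticAt_iteratedDeriv hf k).congr (cderiv_comp_symm_eventuallyEq h f k).symm

lemma dz_cderiv [CompleteSpace F] (h : IsCoordAt e p) {f : M → F}
    (hf : IsRegularAt e f p) (k : ℕ) : dz e (cderiv e k f) p = cderiv e (k + 1) f p := by
  rw [dz_of_isRegularAt (hf.cderiv h k), CoveringUnitons.cderiv, iteratedDeriv_one,
    (cderiv_comp_symm_eventuallyEq h f k).deriv_eq, CoveringUnitons.cderiv, iteratedDeriv_succ]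

lemma cderiv_clm [CompleteSpace F] (L : F →L[ℂ] X) {f : M → F} (hf : IsRegularAt e f p)
    (k : ℕ) : CoveringUnitons.cderiv e k (fun q => L (f q)) p =
      L (CoveringUnitons.cderiv e k f p) := by
  have h1 : (fun q => L (f q)) ∘ e.symm = L ∘ (f ∘ e.symm) := rfl
  simp only [CoveringUnitons.cderiv, h1, iteratedDeriv_eq_iteratedFDeriv]
  rw [L.iteratedFDeriv_comp_left (AnalyticAt.contDiffAt hf (n := k)) le_rfl]
  rfl

end Wirtinger

section Star

set_option linter.unusedSectionVars false

variable {M : Type*} [TopologicalSpace M] [ChartedSpace ℂ M]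
variable {E : Type*} [NormedAddCommGroup E] [InnerProductSpace ℂ E] [CompleteSpace E]
variable {e : OpenPartialHomeomorph M ℂ} {p : M}

lemma SmoothAt.star {f : M → E →L[ℂ] E} (hf : SmoothAt e f p) :
    SmoothAt e (fun q => star (f q)) p :=
  (starL' ℝ : (E →L[ℂ] E) ≃L[ℝ] (E →L[ℂ] E)).contDiff.contDiffAt.comp _ hf

lemma wirt_star (c : ℂ) {f : M → E →L[ℂ] E} (hf : SmoothAt e f p) :
    wirt c e (fun q => star (f q)) p = star (wirt (star c) e f p) := by
  have h1 : HasFDerivAt ((fun q => Star.star (f q)) ∘ e.symm) _ (e p) :=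
    (starL' ℝ : (E →L[ℂ] E) ≃L[ℝ] (E →L[ℂ] E)).toContinuousLinearMap.hasFDerivAt.comp (e p)
      hf.differentiableAt.hasFDerivAt
  simp only [wirt, h1.fderiv]
  simp

end Star

/-! ### The elementary functions `C^i_s` and the sums `∑ C^i_{s+m} x_s` -/

section Elementary

set_option linter.unusedSectionVars false

variable {M : Type*} [TopologicalSpace M] [ChartedSpace ℂ M] {n : ℕ}
variable (α : ℕ → Subbundle M (Cn n)) (r : ℕ) (p : M)

lemma proj_eq (β : Subbundle M (Cn n)) (p : M) : β.proj p = 1 - β.projPerp p := by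
  rw [projPerp_eq, sub_sub_cancel]

lemma projPerp_mul_self (β : Subbundle M (Cn n)) (p : M) :
    β.projPerp p * β.projPerp p = β.projPerp p :=
  Submodule.isIdempotentElem_starProjection _

lemma star_projPerp (β : Subbundle M (Cn n)) (p : M) : star (β.projPerp p) = β.projPerp p :=
  (isSelfAdjoint_starProjection _).star_eq

lemma star_proj (β : Subbundle M (Cn n)) (p : M) : star (β.proj p) = β.proj p :=
  (isSelfAdjoint_starProjection _).star_eq

lemma mem_fiber_iff (β : Subbundle M (Cn n)) (p : M) (v : Cn n) :
    v ∈ β.fiber p ↔ β.projPerp p v = 0 := by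
  rw [Subbundle.projPerp, Submodule.starProjection_apply_eq_zero_iff,
    Submodule.orthogonal_orthogonal]

lemma proj_apply_mem (β : Subbundle M (Cn n)) (p : M) (v : Cn n) : β.proj p v ∈ β.fiber p :=
  Submodule.starProjection_apply_mem _ _

lemma proj_apply_of_mem (β : Subbundle M (Cn n)) (p : M) {v : Cn n} (h : v ∈ β.fiber p) :
    β.proj p v = v :=
  Submodule.starProjection_eq_self_iff.2 h

lemma endC_mul_apply (S T : EndC n) (v : Cn n) : (S * T) v = S (T v) := rfl

lemma proj_projPerp_apply (β : Subbundle M (Cn n)) (p : M) (v : Cn n) :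
    β.proj p (β.projPerp p v) = 0 := by
  have h := congrArg (fun L : EndC n => L v) (projPerp_mul_self β p)
  simp only [endC_mul_apply] at h
  rw [proj_eq]
  simp [h]

lemma C_zero (i : ℕ) : C α i 0 p = 1 := by
  simp [C]

lemma C_eq_zero {i s : ℕ} (h : i < s) : C α i s p = 0 := by
  rw [C, Finset.powersetCard_eq_empty.2 (by simpa using h), Finset.sum_empty]

lemma C_succ_succ (i s : ℕ) :
    C α (i + 1) (s + 1) p = C α i (s + 1) p + (α (i + 1)).projPerp p * C α i s p := by
  have hi : Finset.Icc 1 (i + 1) = insert (i + 1) (Finset.Icc 1 i) := by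
    ext a; simp; omega
  have hni : i + 1 ∉ Finset.Icc 1 i := by simp
  have hsub : ∀ S ∈ (Finset.Icc 1 i).powersetCard s, i + 1 ∉ S := fun S hS h =>
    hni ((Finset.mem_powersetCard.1 hS).1 h)
  rw [C, hi, Finset.powersetCard_succ_insert hni, Finset.sum_union, Finset.sum_image, C, C,
    Finset.mul_sum]
  · congr 1
    refine Finset.sum_congr rfl fun S hS => ?_
    rw [Finset.sort_insert (fun a b : ℕ => b ≤ a) _ (hsub S hS)]
    · simp
    · intro b hb
      have := (Finset.mem_powersetCard.1 hS).1 hb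
      simp at this
      omega
  · intro S hS T hT hST
    rw [← Finset.erase_insert (hsub S hS), ← Finset.erase_insert (hsub T hT), hST]
  · rw [Finset.disjoint_right]
    intro S hS hS'
    obtain ⟨T, -, rfl⟩ := Finset.mem_image.1 hS
    exact hni ((Finset.mem_powersetCard.1 hS').1 (Finset.mem_insert_self _ _))

/-- The operator `x ↦ ∑_s C^i_{s+m} x_s` on `ℂ^{rn}`. Applied with `m = k` to the `k`-th
derivatives of the components of `H` it gives `K^{(k)}_i`. -/
def Csum (i m : ℕ) (p : M) : Crn r n →L[ℂ] Cn n :=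
  ∑ s : Fin r, C α i (s + m) p ∘L PiLp.proj 2 (fun _ : Fin r => Cn n) s

lemma Csum_apply (i m : ℕ) (x : Crn r n) :
    Csum α r i m p x = ∑ s : Fin r, C α i (s + m) p (x s) := by
  simp [Csum]

lemma Csum_eq_zero {i m : ℕ} (h : i < m) (x : Crn r n) : Csum α r i m p x = 0 := by
  rw [Csum_apply]
  exact Finset.sum_eq_zero fun s _ => by rw [C_eq_zero α p (by omega)]; rfl

lemma Csum_succ_succ (i m : ℕ) (x : Crn r n) :
    Csum α r (i + 1) (m + 1) p x =
      Csum α r i (m + 1) p x + (α (i + 1)).projPerp p (Csum α r i m p x) := by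
  simp only [Csum_apply, ← add_assoc, C_succ_succ, add_apply, map_sum,
    Finset.sum_add_distrib, endC_mul_apply]

/-- All terms of `C^{i+1}_s - C^i_s` begin with `π_{i+1}^⊥`. -/
lemma proj_Csum_succ (i m : ℕ) (x : Crn r n) :
    (α (i + 1)).proj p (Csum α r (i + 1) m p x) = (α (i + 1)).proj p (Csum α r i m p x) := by
  have key : ∀ s, ∀ v, (α (i + 1)).proj p (C α (i + 1) s p v) =
      (α (i + 1)).proj p (C α i s p v) := by
    intro s v
    cases s with
    | zero => simp [C_zero]
    | succ s =>
      rw [C_succ_succ, add_apply, map_add, endC_mul_apply,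
        proj_projPerp_apply, add_zero]
  simp only [Csum_apply, map_sum, key]

/-- If `∑_s C^j_{s+m} x_s` lies in `α_{j+1}` for `j < i`, then `∑_s C^i_{s+m+1} x_s = 0`. -/
lemma Csum_succ_eq_zero {i m : ℕ} {x : Crn r n}
    (h : ∀ j < i, Csum α r j m p x ∈ (α (j + 1)).fiber p) : Csum α r i (m + 1) p x = 0 := by
  induction i with
  | zero => exact Csum_eq_zero α r p (by omega) x
  | succ i ih =>
    rw [Csum_succ_succ, ih fun j hj => h j (by omega), zero_add]
    exact (mem_fiber_iff _ _ _).1 (h i (by omega))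

/-- Under the same hypothesis, `∑_s C^i_{s+m'} x_s = 0` for all `m' > m`. -/
lemma Csum_eq_zero_of_lt {i m m' : ℕ} (hm : m < m') {x : Crn r n}
    (h : ∀ j < i, Csum α r j m p x ∈ (α (j + 1)).fiber p) : Csum α r i m' p x = 0 := by
  obtain ⟨d, rfl⟩ := Nat.exists_eq_add_of_lt hm
  induction d generalizing i with
  | zero => exact Csum_succ_eq_zero α r p h
  | succ d ih =>
    refine Csum_succ_eq_zero α r p fun j hj => ?_
    rw [show m + (d + 1) = m + d + 1 by ring, ih (fun l hl => h l (by omega)) (by omega)]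
    exact Submodule.zero_mem _

lemma K_eq_sum (e : OpenPartialHomeomorph M ℂ) (H : ℕ → M → Cn n) {i k : ℕ} (hi : i < r) :
    K α e H i k p = ∑ s : Fin r, C α i (s + k) p (cderiv e k (H s) p) := by
  rw [Finset.sum_fin_eq_sum_range, K]
  symm
  refine Finset.sum_bij_ne_zero (fun t _ _ => t + k) ?_ ?_ ?_ ?_
  · intro t ht h0
    refine Finset.mem_Icc.2 ⟨by omega, ?_⟩
    by_contra hlt
    apply h0
    rw [dif_pos (Finset.mem_range.1 ht), C_eq_zero α p (by simpa using hlt)]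
    simp
  · intro t _ _ t' _ _ h
    omega
  · intro s hs h0
    obtain ⟨h1, h2⟩ := Finset.mem_Icc.1 hs
    refine ⟨s - k, Finset.mem_range.2 (by omega), ?_, by omega⟩
    rw [dif_pos (by omega)]
    simpa [Nat.sub_add_cancel h1] using h0
  · intro t ht h0
    rw [dif_pos (Finset.mem_range.1 ht)]
    simp

lemma cderiv_comp {e : OpenPartialHomeomorph M ℂ} {H : M → Crn r n} (hH : IsRegularAt e H p)
    (k : ℕ) (s : Fin r) : cderiv e k (comp H s) p = cderiv e k H p s := by
  have : comp H s = fun q => PiLp.proj 2 (𝕜 := ℂ) (fun _ : Fin r => Cn n) s (H q) := by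
    funext q; simp [comp]
  rw [this, cderiv_clm _ hH]
  simp

lemma K_eq_Csum {e : OpenPartialHomeomorph M ℂ} {H : M → Crn r n} (hH : IsRegularAt e H p)
    {i : ℕ} (k : ℕ) (hi : i < r) :
    K α e (comp H) i k p = Csum α r i k p (cderiv e k H p) := by
  rw [K_eq_sum α r p e _ hi, Csum_apply]
  simp only [cderiv_comp r p hH]

end Elementary

/-! ### Smoothness of the data of a sequence of bundles -/

section Smoothness

variable {M : Type*} [TopologicalSpace M] [ChartedSpace ℂ M] [IsManifold 𝓘(ℂ) ω M] {n : ℕ}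
variable {α : ℕ → Subbundle M (Cn n)} {e : OpenPartialHomeomorph M ℂ} {p : M}

lemma smoothAt_proj (h : IsCoordAt e p) (β : Subbundle M (Cn n)) : SmoothAt e β.proj p :=
  β.smooth.smoothAt h

lemma smoothAt_projPerp (h : IsCoordAt e p) (β : Subbundle M (Cn n)) :
    SmoothAt e β.projPerp p :=
  ((SmoothAt.const 1).sub (smoothAt_proj h β)).congr h (.of_forall fun q => (projPerp_eq β q).symm)

lemma smoothAt_C (h : IsCoordAt e p) (i s : ℕ) : SmoothAt e (C α i s) p := by
  induction i generalizing s with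
  | zero =>
    cases s with
    | zero => exact (SmoothAt.const 1).congr h (.of_forall fun q => (C_zero α q 0).symm)
    | succ s =>
      exact (SmoothAt.const 0).congr h (.of_forall fun q => (C_eq_zero α q (by omega)).symm)
  | succ i ih =>
    cases s with
    | zero => exact (SmoothAt.const 1).congr h (.of_forall fun q => (C_zero α q _).symm)
    | succ s =>
      exact ((ih (s + 1)).add ((smoothAt_projPerp h _).mul (ih s))).congr h
        (.of_forall fun q => (C_succ_succ α q i s).symm)

lemma smoothAt_Csum (h : IsCoordAt e p) (r i m : ℕ) : SmoothAt e (Csum α r i m) p := by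
  have h1 : Csum α r i m = fun q => ∑ s : Fin r,
    C α i (s + m) q ∘L PiLp.proj 2 (𝕜 := ℂ) (fun _ : Fin r => Cn n) s := rfl
  rw [h1]
  refine SmoothAt.sum fun s _ => ?_
  exact (smoothAt_C h i (s + m)).clm_comp (F := Crn r n) (SmoothAt.const _)

lemma smoothAt_phi (h : IsCoordAt e p) (φ₀ : Un n) (i : ℕ) :
    SmoothAt e (fun q => (phi φ₀ α i q : EndC n)) p := by
  induction i with
  | zero => exact SmoothAt.const (φ₀ : EndC n)
  | succ i ih => exact ih.mul ((smoothAt_proj h _).sub (smoothAt_projPerp h _))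

end Smoothness

/-! ### Noncommutative identities for the addition of a uniton -/

section RingIdentities

variable {R : Type*} [Ring R] {P A A' D D' : R}

lemma mul_deriv_of_normal (hd : D' * P + P * D' = D') (h : (P * A' - D') * (1 - P) = 0)
    (r : A' * P = P * A' * P) : P * D' = P * A' - A' * P := by
  linear_combination (norm := noncomm_ring) -h + r + hd

lemma deriv_mul_of_normal (hd : D * P + P * D = D) (h : (1 - P) * (-A * P - D) = 0)
    (r : P * A = P * A * P) : D * P = P * A - A * P := by
  linear_combination (norm := noncomm_ring) -h - r + hd

lemma reflection_conj {U V W a : R} (hu : V * U = 1) (ha : V * W = a + a) :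
    (1 - P - P) * V * (W * (1 - P - P) + U * (-D - D)) =
      ((1 - P - P) * a * (1 - P - P) - (1 - P - P) * D) +
        ((1 - P - P) * a * (1 - P - P) - (1 - P - P) * D) := by
  linear_combination (norm := noncomm_ring)
    (1 - P - P) * ha * (1 - P - P) + (1 - P - P) * hu * (-D - D)

lemma reflection_conj_eq_add (hd : D * P + P * D = D) (r1 : P * A = P * A * P)
    (r4 : D * P = P * A - A * P) :
    (1 - P - P) * A * (1 - P - P) - (1 - P - P) * D = A + D := by
  linear_combination (norm := noncomm_ring) -r1 - r1 - r1 - r1 + hd + hd - r4 - r4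

lemma reflection_conj_eq_sub (r2 : A' * P = P * A' * P) (r3 : P * D' = P * A' - A' * P) :
    (1 - P - P) * A' * (1 - P - P) - (1 - P - P) * D' = A' - D' := by
  linear_combination (norm := noncomm_ring) -r2 - r2 - r2 - r2 + r3 + r3

/-- The harmonic map equation after the addition of a uniton. Here `Y = ∂_z̄ ∂_z P`; the
hypotheses are the derivatives of `P ∂_z̄P = [P, A_z̄]`, of `∂_zP P = [P, A_z]` and, twice, of
`P * P = P`. -/
lemma harmonic_equation_succ {Y : R}
    (d3 : D * D' + P * Y =
      D * A' + P * (A' * A - A * A') - ((A' * A - A * A') * P + A' * D))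
    (d4 : Y * P + D * D' =
      D' * A + P * (A * A' - A' * A) - ((A * A' - A' * A) * P + A * D'))
    (d0 : Y * P + D * D' + (D' * D + P * Y) = Y) :
    A * A' - A' * A + Y + ((A' - D') * (A + D) - (A + D) * (A' - D')) = 0 := by
  linear_combination (norm := noncomm_ring) d3 + d4 - d0

lemma C_step_dz {c c' : R} (r4 : D * P = P * A - A * P) :
    A * c + (D * c + P * (A * c')) = (A + D) * (c + P * c') := by
  linear_combination (norm := noncomm_ring) -r4 * c'

lemma C_step_dzbar {c c' E E' F : R} (hd : D' * P + P * D' = D') (r3 : P * D' = P * A' - A' * P)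
    (h : E + E' = -(A' * c)) (h' : E' + F = -(A' * c')) :
    (E + (D' * c + P * E')) + (E' + (D' * c' + P * F)) =
      -((A' - D') * (c + P * c')) := by
  linear_combination (norm := noncomm_ring) h + P * h' - hd * c' + r3 * c'

end RingIdentities

lemma eq_half_add_half {V : Type*} [AddCommGroup V] [Module ℂ V] {x a : V}
    (h : a = (1 / 2 : ℂ) • x) : x = a + a := by
  rw [h, ← add_smul]; norm_num

lemma half_smul_add_self {V : Type*} [AddCommGroup V] [Module ℂ V] {x a : V}
    (h : x = a + a) : (1 / 2 : ℂ) • x = a := by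
  rw [h, smul_add, ← add_smul]; norm_num

/-! ### Unitons and the addition of a uniton -/

section Unitons

set_option linter.unusedSectionVars false

variable {M : Type*} [TopologicalSpace M] [ChartedSpace ℂ M] [IsManifold 𝓘(ℂ) ω M] {n : ℕ}
variable {e : OpenPartialHomeomorph M ℂ} {p : M} {φ : M → Un n} {β : Subbundle M (Cn n)}

lemma wirt_projPerp (h : IsCoordAt e p) (c : ℂ) (β : Subbundle M (Cn n)) :
    wirt c e β.projPerp p * β.projPerp p + β.projPerp p * wirt c e β.projPerp p =
      wirt c e β.projPerp p := by
  have hs := smoothAt_projPerp h β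
  rw [← wirt_mul h c hs hs]
  exact wirt_congr h (.of_forall fun q => projPerp_mul_self β q) c

lemma wirt_proj (h : IsCoordAt e p) (c : ℂ) (β : Subbundle M (Cn n)) :
    wirt c e β.proj p = -wirt c e β.projPerp p := by
  rw [wirt_congr h (g := fun q => 1 - β.projPerp q) (.of_forall fun q => proj_eq β q),
    wirt_sub c (SmoothAt.const _) (smoothAt_projPerp h β), wirt_const, zero_sub]

lemma star_wirt_projPerp (c : ℂ) (h : IsCoordAt e p) (β : Subbundle M (Cn n)) :
    star (wirt c e β.projPerp p) = wirt (star c) e β.projPerp p := by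
  have h1 := wirt_star (star c) (smoothAt_projPerp h β)
  rw [star_star] at h1
  rw [← h1]
  exact wirt_congr h (.of_forall fun q => star_projPerp β q) _

lemma Az_eq (φ : M → Un n) : Az e φ = fun q =>
    (1 / 2 : ℂ) • (star (φ q : EndC n) * wirt (-Complex.I) e (fun q => (φ q : EndC n)) q) := by
  funext q
  rw [Az, dz_eq_wirt]
  rfl

lemma Azbar_eq (φ : M → Un n) : Azbar e φ = fun q =>
    (1 / 2 : ℂ) • (star (φ q : EndC n) * wirt Complex.I e (fun q => (φ q : EndC n)) q) := by
  funext q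
  rw [Azbar, dzbar_eq_wirt]
  rfl

lemma smoothAt_Az (h : IsCoordAt e p) (hφ : SmoothAt e (fun q => (φ q : EndC n)) p) :
    SmoothAt e (Az e φ) p := by
  rw [Az_eq]
  exact (hφ.star.mul (hφ.wirt h _)).const_smul _

lemma smoothAt_Azbar (h : IsCoordAt e p) (hφ : SmoothAt e (fun q => (φ q : EndC n)) p) :
    SmoothAt e (Azbar e φ) p := by
  rw [Azbar_eq]
  exact (hφ.star.mul (hφ.wirt h _)).const_smul _

lemma star_mul_phi (q : M) : star (φ q : EndC n) * (φ q : EndC n) = 1 :=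
  Unitary.coe_star_mul_self (φ q)

/-- `A_z̄ = -A_z^*`. -/
lemma star_Az (h : IsCoordAt e p) (hφ : SmoothAt e (fun q => (φ q : EndC n)) p) :
    star (Az e φ p) = -Azbar e φ p := by
  have h1 : wirt Complex.I e (fun q => star (φ q : EndC n) * (φ q : EndC n)) p = 0 := by
    rw [wirt_congr h (.of_forall fun q => star_mul_phi q), wirt_const]
  rw [wirt_mul h _ hφ.star hφ, wirt_star _ hφ] at h1
  have h2 : star Complex.I = -Complex.I := Complex.conj_I
  rw [h2] at h1
  rw [Az_eq, Azbar_eq]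
  simp only [star_smul, star_mul, star_star, eq_neg_of_add_eq_zero_left h1, smul_neg]
  congr 2
  simp

lemma star_Azbar (h : IsCoordAt e p) (hφ : SmoothAt e (fun q => (φ q : EndC n)) p) :
    star (Azbar e φ p) = -Az e φ p := by
  have h1 := congrArg star (star_Az h hφ)
  rw [star_star, ContinuousLinearMap.star_eq_adjoint, map_neg] at h1
  exact (neg_eq_iff_eq_neg.2 h1).symm

/-- The uniton conditions at `p`, as identities between operators. -/
def IsUnitonAt (e : OpenPartialHomeomorph M ℂ) (φ : M → Un n) (β : Subbundle M (Cn n))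
    (p : M) : Prop :=
  β.projPerp p * Az e φ p * β.proj p = 0 ∧
    (β.projPerp p * Azbar e φ p - dzbar e β.projPerp p) * β.proj p = 0

/-- The component of `D_z̄ σ` normal to `β` depends only on the value of the section `σ`. -/
lemma projPerp_Dzbar (h : IsCoordAt e p) (φ : M → Un n) {σ : M → Cn n}
    (hσ : SmoothAt e σ p) (hm : ∀ᶠ q in 𝓝 p, σ q ∈ β.fiber q) :
    β.projPerp p (Dzbar e φ σ p) =
      (β.projPerp p * Azbar e φ p - dzbar e β.projPerp p) (σ p) := by
  have h1 : wirt Complex.I e (fun q => β.projPerp q (σ q)) p = 0 := by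
    rw [wirt_congr h (hm.mono fun q hq => (mem_fiber_iff β q _).1 hq), wirt_const]
  rw [wirt_clm_apply h _ (smoothAt_projPerp h β) hσ] at h1
  rw [Dzbar, dzbar_eq_wirt, dzbar_eq_wirt, map_add, eq_neg_of_add_eq_zero_right h1, sub_apply,
    endC_mul_apply]
  abel

/-- The uniton conditions are tensorial, so that it suffices to test them on the sections `π v`
with constant `v`. -/
lemma isUniton_iff : IsUniton φ β ↔
    IsHarmonic φ ∧ ∀ e p, IsCoordAt e p → IsUnitonAt e φ β p := by
  constructor
  · refine fun hu => ⟨hu.harmonic, fun e p h => ?_⟩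
    have hσ : ∀ v, β.IsSection (fun q => β.proj q v) := fun v =>
      ⟨isSmooth_iff.2 fun e q hq => (smoothAt_proj hq β).clm_apply (SmoothAt.const v),
        fun q => proj_apply_mem β q v⟩
    refine ⟨?_, ?_⟩
    · ext1 v
      exact (mem_fiber_iff _ _ _).1 (hu.closed _ (hσ v) e p h)
    · ext1 v
      rw [endC_mul_apply, ← projPerp_Dzbar h φ ((hσ v).1.smoothAt h) (.of_forall (hσ v).2)]
      exact (mem_fiber_iff _ _ _).1 (hu.holomorphic _ (hσ v) e p h)
  · rintro ⟨hh, hu⟩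
    refine ⟨hh, fun σ hσ e p h => ?_, fun σ hσ e p h => ?_⟩
    · rw [mem_fiber_iff, projPerp_Dzbar h φ (hσ.1.smoothAt h) (.of_forall hσ.2)]
      have := congrArg (fun L : EndC n => L (σ p)) (hu e p h).2
      rwa [endC_mul_apply, proj_apply_of_mem β p (hσ.2 p)] at this
    · rw [mem_fiber_iff]
      have := congrArg (fun L : EndC n => L (σ p)) (hu e p h).1
      rwa [endC_mul_apply, proj_apply_of_mem β p (hσ.2 p)] at this

/-- The consequences of the uniton conditions for `P = π^⊥`, `A = A_z` and `Ā = A_z̄`. The second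
identity is the adjoint of `P A π = 0`, and the fourth one comes from the adjoint of the condition
on `Ā`. -/
lemma IsUnitonAt.relations (h : IsCoordAt e p) (hφ : SmoothAt e (fun q => (φ q : EndC n)) p)
    (hu : IsUnitonAt e φ β p) :
    β.projPerp p * Az e φ p = β.projPerp p * Az e φ p * β.projPerp p ∧
    Azbar e φ p * β.projPerp p = β.projPerp p * Azbar e φ p * β.projPerp p ∧
    β.projPerp p * wirt Complex.I e β.projPerp p =
      β.projPerp p * Azbar e φ p - Azbar e φ p * β.projPerp p ∧
    wirt (-Complex.I) e β.projPerp p * β.projPerp p =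
      β.projPerp p * Az e φ p - Az e φ p * β.projPerp p := by
  obtain ⟨h1, h2⟩ := hu
  rw [dzbar_eq_wirt] at h2
  have h1' := congrArg star h1
  have h2' := congrArg star h2
  have hI : star Complex.I = -Complex.I := Complex.conj_I
  simp only [star_mul, star_sub, star_proj, star_projPerp, star_Az h hφ, star_Azbar h hφ,
    star_wirt_projPerp _ h, hI, star_zero] at h1' h2'
  have hd := wirt_projPerp h Complex.I β
  have hd' := wirt_projPerp h (-Complex.I) β
  rw [proj_eq] at h1 h2 h1' h2'
  have r1 : β.projPerp p * Az e φ p = β.projPerp p * Az e φ p * β.projPerp p := by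
    rw [mul_sub, mul_one] at h1
    exact sub_eq_zero.1 h1
  have r2 : Azbar e φ p * β.projPerp p = β.projPerp p * Azbar e φ p * β.projPerp p := by
    rw [sub_mul, one_mul, neg_mul, mul_neg, ← mul_assoc] at h1'
    exact neg_injective (sub_eq_zero.1 h1')
  exact ⟨r1, r2, mul_deriv_of_normal hd h2 r2, deriv_mul_of_normal hd' h2' r1⟩

/-- The effect on `φ⁻¹ ∂φ / 2` of multiplying `φ` by `π - π^⊥`. -/
lemma half_conj (h : IsCoordAt e p) (c : ℂ) (hφ : SmoothAt e (fun q => (φ q : EndC n)) p)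
    (β : Subbundle M (Cn n)) {a P D : EndC n} (hP : P = β.projPerp p)
    (hD : D = wirt c e β.projPerp p)
    (ha : a = (1 / 2 : ℂ) • (star (φ p : EndC n) * wirt c e (fun q => (φ q : EndC n)) p)) :
    (1 / 2 : ℂ) • (star ((φ p * cartan β p : Un n) : EndC n) *
      wirt c e (fun q => ((φ q * cartan β q : Un n) : EndC n)) p) =
      (1 - P - P) * a * (1 - P - P) - (1 - P - P) * D := by
  have hc : ∀ q, β.proj q - β.projPerp q = 1 - β.projPerp q - β.projPerp q := fun q => by
    rw [proj_eq]
  have hst : star ((φ p * cartan β p : Un n) : EndC n) = (1 - P - P) * star (φ p : EndC n) := by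
    have h1 : star (β.proj p - β.projPerp p) = 1 - P - P := by
      rw [star_sub, star_proj, star_projPerp, hc, hP]
    rw [← h1, ← star_mul]
    rfl
  have hs : SmoothAt e (fun q => β.proj q - β.projPerp q) p :=
    (smoothAt_proj h β).sub (smoothAt_projPerp h β)
  have hw : wirt c e (fun q => ((φ q * cartan β q : Un n) : EndC n)) p =
      wirt c e (fun q => (φ q : EndC n)) p * (1 - P - P) + (φ p : EndC n) * (-D - D) := by
    have h1 := wirt_mul h c hφ hs
    rw [wirt_sub c (smoothAt_proj h β) (smoothAt_projPerp h β), wirt_proj h, hc, ← hP, ← hD] at h1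
    exact h1
  rw [hst, hw]
  exact half_smul_add_self (reflection_conj (star_mul_phi p) (eq_half_add_half ha))

end Unitons

/-! ### Harmonicity and the derivatives of `C^i_s` along a sequence of unitons -/

section Sequence

set_option linter.unusedSectionVars false

variable {M : Type*} [TopologicalSpace M] [ChartedSpace ℂ M] [IsManifold 𝓘(ℂ) ω M] {n : ℕ}
variable {e : OpenPartialHomeomorph M ℂ} {p : M} {φ₀ : Un n} {α : ℕ → Subbundle M (Cn n)} {i : ℕ}

lemma Az_phi_succ (h : IsCoordAt e p) (hu : IsUnitonAt e (phi φ₀ α i) (α (i + 1)) p) :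
    Az e (phi φ₀ α (i + 1)) p =
      Az e (phi φ₀ α i) p + wirt (-Complex.I) e (α (i + 1)).projPerp p := by
  have hφ := smoothAt_phi (α := α) h φ₀ i
  obtain ⟨r1, -, -, r4⟩ := hu.relations h hφ
  have hd := wirt_projPerp h (-Complex.I) (α (i + 1))
  have h1 : Az e (phi φ₀ α (i + 1)) p = _ :=
    (congrFun (Az_eq _) p).trans (half_conj h (-Complex.I) hφ (α (i + 1)) rfl rfl
      (congrFun (Az_eq (e := e) (phi φ₀ α i)) p))
  rw [h1, reflection_conj_eq_add hd r1 r4]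

lemma Azbar_phi_succ (h : IsCoordAt e p) (hu : IsUnitonAt e (phi φ₀ α i) (α (i + 1)) p) :
    Azbar e (phi φ₀ α (i + 1)) p =
      Azbar e (phi φ₀ α i) p - wirt Complex.I e (α (i + 1)).projPerp p := by
  have hφ := smoothAt_phi (α := α) h φ₀ i
  obtain ⟨-, r2, r3, -⟩ := hu.relations h hφ
  have h1 : Azbar e (phi φ₀ α (i + 1)) p = _ :=
    (congrFun (Azbar_eq _) p).trans (half_conj h Complex.I hφ (α (i + 1)) rfl rfl
      (congrFun (Azbar_eq (e := e) (phi φ₀ α i)) p))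
  rw [h1, reflection_conj_eq_sub r2 r3]

lemma IsHarmonic.wirt_Az (hφ : IsHarmonic (phi φ₀ α i)) (h : IsCoordAt e p) :
    wirt Complex.I e (Az e (phi φ₀ α i)) p =
      Az e (phi φ₀ α i) p * Azbar e (phi φ₀ α i) p -
        Azbar e (phi φ₀ α i) p * Az e (phi φ₀ α i) p := by
  have := hφ.equation e p h
  rw [dzbar_eq_wirt] at this
  rw [eq_neg_of_add_eq_zero_left this, neg_sub]

/-- The adjoint of the harmonic map equation. -/
lemma IsHarmonic.wirt_Azbar (hφ : IsHarmonic (phi φ₀ α i)) (h : IsCoordAt e p) :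
    wirt (-Complex.I) e (Azbar e (phi φ₀ α i)) p =
      Azbar e (phi φ₀ α i) p * Az e (phi φ₀ α i) p -
        Az e (phi φ₀ α i) p * Azbar e (phi φ₀ α i) p := by
  have hs := smoothAt_phi (α := α) h φ₀ i
  have h1 : ∀ᶠ q in 𝓝 p, star (Azbar e (phi φ₀ α i) q) = (-1 : ℂ) • Az e (phi φ₀ α i) q := by
    filter_upwards [h.eventually] with q hq
    rw [star_Azbar hq (smoothAt_phi hq φ₀ i), neg_one_smul ℂ (Az e (phi φ₀ α i) q)]
  have h2 := wirt_star Complex.I (smoothAt_Azbar h hs)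
  have hI : star Complex.I = -Complex.I := Complex.conj_I
  rw [wirt_congr h h1, hI, wirt_const_smul _ _ (smoothAt_Az h hs),
    hφ.wirt_Az h, neg_one_smul ℂ (_ : EndC n), neg_sub] at h2
  have h3 := congrArg star h2
  rw [star_star] at h3
  rw [← h3]
  rw [star_sub, star_mul, star_mul, star_Az h hs, star_Azbar h hs, neg_mul_neg, neg_mul_neg]

/-- Multiplying a harmonic map by the Cartan embedding of a uniton gives a harmonic map. -/
lemma IsUniton.isHarmonic_succ (hu : IsUniton (phi φ₀ α i) (α (i + 1))) :
    IsHarmonic (phi φ₀ α (i + 1)) := by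
  obtain ⟨hh, hu⟩ := isUniton_iff.1 hu
  refine ⟨isSmooth_iff.2 fun e p h => smoothAt_phi h φ₀ (i + 1), fun e p h => ?_⟩
  have hφ := smoothAt_phi (α := α) h φ₀ i
  have hP := smoothAt_projPerp h (α (i + 1))
  have hA := smoothAt_Az h hφ
  have hA' := smoothAt_Azbar h hφ
  -- the two relations between `P`, `A_z`, `A_z̄` are differentiated along `∂_z` and `∂_z̄`
  have e3 : ∀ᶠ q in 𝓝 p, (α (i + 1)).projPerp q * wirt Complex.I e (α (i + 1)).projPerp q =
      (α (i + 1)).projPerp q * Azbar e (phi φ₀ α i) q -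
        Azbar e (phi φ₀ α i) q * (α (i + 1)).projPerp q := by
    filter_upwards [h.eventually] with q hq
    exact ((hu e q hq).relations hq (smoothAt_phi hq φ₀ i)).2.2.1
  have e4 : ∀ᶠ q in 𝓝 p, wirt (-Complex.I) e (α (i + 1)).projPerp q * (α (i + 1)).projPerp q =
      (α (i + 1)).projPerp q * Az e (phi φ₀ α i) q -
        Az e (phi φ₀ α i) q * (α (i + 1)).projPerp q := by
    filter_upwards [h.eventually] with q hq
    exact ((hu e q hq).relations hq (smoothAt_phi hq φ₀ i)).2.2.2
  have d3 := wirt_congr h e3 (-Complex.I)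
  have d4 := wirt_congr h e4 Complex.I
  rw [wirt_mul h _ hP (hP.wirt h _), wirt_sub _ (hP.mul hA') (hA'.mul hP), wirt_mul h _ hP hA',
    wirt_mul h _ hA' hP, hh.wirt_Azbar h, wirt_comm h (-Complex.I) Complex.I hP] at d3
  rw [wirt_mul h _ (hP.wirt h _) hP, wirt_sub _ (hP.mul hA) (hA.mul hP), wirt_mul h _ hP hA,
    wirt_mul h _ hA hP, hh.wirt_Az h] at d4
  have e0 : ∀ᶠ q in 𝓝 p, wirt (-Complex.I) e (α (i + 1)).projPerp q * (α (i + 1)).projPerp q +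
      (α (i + 1)).projPerp q * wirt (-Complex.I) e (α (i + 1)).projPerp q =
      wirt (-Complex.I) e (α (i + 1)).projPerp q := by
    filter_upwards [h.eventually] with q hq using wirt_projPerp hq _ _
  have d0 := wirt_congr h e0 Complex.I
  rw [wirt_add _ ((hP.wirt h _).mul hP) (hP.mul (hP.wirt h _)), wirt_mul h _ (hP.wirt h _) hP,
    wirt_mul h _ hP (hP.wirt h _)] at d0
  have hAz : ∀ᶠ q in 𝓝 p, Az e (phi φ₀ α (i + 1)) q =
      Az e (phi φ₀ α i) q + wirt (-Complex.I) e (α (i + 1)).projPerp q := by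
    filter_upwards [h.eventually] with q hq using Az_phi_succ hq (hu e q hq)
  rw [dzbar_eq_wirt, wirt_congr h hAz, wirt_add _ hA (hP.wirt h _), hh.wirt_Az h,
    Az_phi_succ h (hu e p h), Azbar_phi_succ h (hu e p h)]
  exact harmonic_equation_succ d3 d4 d0

lemma wirt_phi_zero (c : ℂ) (q : M) : wirt c e (fun q => (phi φ₀ α 0 q : EndC n)) q = 0 :=
  wirt_const c (φ₀ : EndC n)

lemma Az_phi_zero (q : M) : Az e (phi φ₀ α 0) q = 0 := by
  rw [Az_eq]
  beta_reduce
  rw [wirt_phi_zero, mul_zero, smul_zero]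

lemma Azbar_phi_zero (q : M) : Azbar e (phi φ₀ α 0) q = 0 := by
  rw [Azbar_eq]
  beta_reduce
  rw [wirt_phi_zero, mul_zero, smul_zero]

lemma isHarmonic_phi (hu : IsUnitonSequence φ₀ α i) : IsHarmonic (phi φ₀ α i) := by
  cases i with
  | zero =>
    refine ⟨isSmooth_iff.2 fun e p h => smoothAt_phi h φ₀ 0, fun e p h => ?_⟩
    rw [dzbar_eq_wirt, wirt_congr h (.of_forall Az_phi_zero), wirt_const, Az_phi_zero, mul_zero,
      zero_mul, sub_zero, add_zero]
  | succ i => exact (hu (i + 1) (by omega) le_rfl).isHarmonic_succ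

lemma IsUnitonSequence.mono {j : ℕ} (hu : IsUnitonSequence φ₀ α i) (hj : j ≤ i) :
    IsUnitonSequence φ₀ α j := fun l h1 h2 => hu l h1 (h2.trans hj)

lemma IsUnitonSequence.isUnitonAt {j : ℕ} (hu : IsUnitonSequence φ₀ α i) (hj : j < i)
    (h : IsCoordAt e p) : IsUnitonAt e (phi φ₀ α j) (α (j + 1)) p :=
  (isUniton_iff.1 (hu (j + 1) (by omega) hj)).2 e p h

/-- `∂_z C^i_{s+1} = A_z C^i_s`, where `A_z` belongs to `φ_i`. -/
lemma wirt_C (hu : IsUnitonSequence φ₀ α i) (h : IsCoordAt e p) (s : ℕ) :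
    wirt (-Complex.I) e (C α i (s + 1)) p = Az e (phi φ₀ α i) p * C α i s p := by
  induction i generalizing s with
  | zero =>
    rw [wirt_congr h (.of_forall fun q => C_eq_zero α q (by omega)), wirt_const, Az_phi_zero,
      zero_mul]
  | succ i ih =>
    have ih := ih (hu.mono (by omega))
    have hui := hu.isUnitonAt (Nat.lt_succ_self i) h
    have hP := smoothAt_projPerp h (α (i + 1))
    obtain ⟨-, -, -, r4⟩ := hui.relations h (smoothAt_phi h φ₀ i)
    rw [wirt_congr h (.of_forall fun q => C_succ_succ α q i s),
      wirt_add _ (smoothAt_C h _ _) (hP.mul (smoothAt_C h _ _)), wirt_mul h _ hP (smoothAt_C h _ _),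
      ih, Az_phi_succ h hui]
    cases s with
    | zero =>
      rw [wirt_congr h (.of_forall fun q => C_zero α q i), wirt_const,
        C_zero, C_zero, mul_one, mul_one, mul_one, mul_zero, add_zero]
    | succ s =>
      rw [ih, C_succ_succ]
      exact C_step_dz r4

/-- `∂_z̄ C^i_{s+1} + ∂_z̄ C^i_s = -A_z̄ C^i_s`, where `A_z̄` belongs to `φ_i`. -/
lemma wirt_C_add (hu : IsUnitonSequence φ₀ α i) (h : IsCoordAt e p) (s : ℕ) :
    wirt Complex.I e (C α i (s + 1)) p + wirt Complex.I e (C α i s) p =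
      -(Azbar e (phi φ₀ α i) p * C α i s p) := by
  induction i generalizing s with
  | zero =>
    have hc : wirt Complex.I e (C α 0 s) p = 0 := by
      cases s with
      | zero => rw [wirt_congr h (.of_forall fun q => C_zero α q 0), wirt_const]
      | succ s => rw [wirt_congr h (.of_forall fun q => C_eq_zero α q (by omega)), wirt_const]
    rw [hc, wirt_congr h (.of_forall fun q => C_eq_zero α q (by omega)), wirt_const,
      Azbar_phi_zero, zero_mul, neg_zero, add_zero]
  | succ i ih =>
    have ih := ih (hu.mono (by omega))
    have hui := hu.isUnitonAt (Nat.lt_succ_self i) h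
    have hP := smoothAt_projPerp h (α (i + 1))
    obtain ⟨-, -, r3, -⟩ := hui.relations h (smoothAt_phi h φ₀ i)
    have hd := wirt_projPerp h Complex.I (α (i + 1))
    have hstep : ∀ s, wirt Complex.I e (C α (i + 1) (s + 1)) p =
        wirt Complex.I e (C α i (s + 1)) p +
          (wirt Complex.I e (α (i + 1)).projPerp p * C α i s p +
            (α (i + 1)).projPerp p * wirt Complex.I e (C α i s) p) := fun s => by
      rw [wirt_congr h (.of_forall fun q => C_succ_succ α q i s),
        wirt_add _ (smoothAt_C h _ _) (hP.mul (smoothAt_C h _ _)),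
        wirt_mul h _ hP (smoothAt_C h _ _)]
    have ih0 := ih s
    cases s with
    | zero =>
      have hc : ∀ j, wirt Complex.I e (C α j 0) p = 0 := fun j => by
        rw [wirt_congr h (.of_forall fun q => C_zero α q j), wirt_const]
      rw [hstep, hc, Azbar_phi_succ h hui]
      rw [hc, C_zero, add_zero, mul_one] at ih0
      rw [hc, C_zero, C_zero, ih0, mul_one, mul_one, mul_zero, add_zero, add_zero, neg_sub,
        neg_add_eq_sub]
    | succ s =>
      rw [hstep, hstep, C_succ_succ, Azbar_phi_succ h hui]
      exact C_step_dzbar hd r3 ih0 (ih s)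

end Sequence

/-! ### Derivatives of the sums `∑ C^i_{s+m} x_s` -/

section DerivCsum

set_option linter.unusedSectionVars false

variable {M : Type*} [TopologicalSpace M] [ChartedSpace ℂ M] [IsManifold 𝓘(ℂ) ω M] {n : ℕ}
variable {e e' : OpenPartialHomeomorph M ℂ} {p : M} {φ₀ : Un n} {α : ℕ → Subbundle M (Cn n)}
  {i r m : ℕ}

lemma wirt_Csum_apply (h : IsCoordAt e p) (c : ℂ) (y : Crn r n) :
    wirt c e (Csum α r i m) p y = ∑ s : Fin r, wirt c e (C α i (s + m)) p (y s) := by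
  have h1 := wirt_clm_apply h c (smoothAt_Csum (α := α) h r i m) (SmoothAt.const y)
  rw [wirt_const, map_zero, add_zero] at h1
  rw [← h1, wirt_congr h (.of_forall fun q => Csum_apply α r q i m y),
    wirt_sum c fun s _ => (smoothAt_C h _ _).clm_apply (SmoothAt.const (y s))]
  refine Finset.sum_congr rfl fun s _ => ?_
  rw [wirt_clm_apply h c (smoothAt_C h _ _) (SmoothAt.const (y s)), wirt_const, map_zero, add_zero]

lemma Az_Csum (hu : IsUnitonSequence φ₀ α i) (h : IsCoordAt e p) (y : Crn r n) :
    Az e (phi φ₀ α i) p (Csum α r i m p y) = wirt (-Complex.I) e (Csum α r i (m + 1)) p y := by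
  rw [wirt_Csum_apply h, Csum_apply, map_sum]
  refine Finset.sum_congr rfl fun s _ => ?_
  rw [← add_assoc, wirt_C hu h, endC_mul_apply]

lemma Azbar_Csum (hu : IsUnitonSequence φ₀ α i) (h : IsCoordAt e p) (y : Crn r n) :
    Azbar e (phi φ₀ α i) p (Csum α r i m p y) =
      -(wirt Complex.I e (Csum α r i (m + 1)) p y + wirt Complex.I e (Csum α r i m) p y) := by
  rw [wirt_Csum_apply h, wirt_Csum_apply h, Csum_apply, map_sum, ← Finset.sum_add_distrib,
    ← Finset.sum_neg_distrib]
  refine Finset.sum_congr rfl fun s _ => ?_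
  have h1 := congrArg (fun L : EndC n => L (y s)) (wirt_C_add hu h (s + m))
  beta_reduce at h1
  rw [add_apply, neg_apply, endC_mul_apply] at h1
  rw [← add_assoc, h1, neg_neg]

lemma Dzbar_Csum (hu : IsUnitonSequence φ₀ α i) (h : IsCoordAt e p) {x : M → Crn r n}
    (hx : SmoothAt e x p) (h0 : ∀ᶠ q in 𝓝 p, Csum α r i (m + 1) q (x q) = 0) :
    Dzbar e (phi φ₀ α i) (fun q => Csum α r i m q (x q)) p =
      Csum α r i m p (dzbar e x p) + Csum α r i (m + 1) p (dzbar e x p) := by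
  have h1 := wirt_clm_apply h Complex.I (smoothAt_Csum (α := α) h r i (m + 1)) hx
  rw [wirt_congr h h0, wirt_const] at h1
  rw [Dzbar, Azbar_Csum hu h, dzbar_eq_wirt, dzbar_eq_wirt,
    wirt_clm_apply h Complex.I (smoothAt_Csum (α := α) h r i m) hx,
    eq_neg_of_add_eq_zero_left h1.symm]
  abel

lemma Az_Csum_eq_neg (hu : IsUnitonSequence φ₀ α i) (h : IsCoordAt e p) {x : M → Crn r n}
    (hx : SmoothAt e x p) (h0 : ∀ᶠ q in 𝓝 p, Csum α r i (m + 1) q (x q) = 0) :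
    Az e (phi φ₀ α i) p (Csum α r i m p (x p)) = -Csum α r i (m + 1) p (dz e x p) := by
  have h1 := wirt_clm_apply h (-Complex.I) (smoothAt_Csum (α := α) h r i (m + 1)) hx
  rw [wirt_congr h h0, wirt_const] at h1
  rw [Az_Csum hu h, dz_eq_wirt, eq_neg_of_add_eq_zero_left h1.symm]

/-- The function `H` generates elements of the bundles at `p`: all `K^{(m)}_j`, formed with the
coordinate `e`, lie in `α_{j+1}`. -/
def IsAdapted (α : ℕ → Subbundle M (Cn n)) (r : ℕ) (e : OpenPartialHomeomorph M ℂ)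
    (H : M → Crn r n) (p : M) : Prop :=
  ∀ j < r, ∀ m, Csum α r j m p (cderiv e m H p) ∈ (α (j + 1)).fiber p

lemma IsAdapted.Csum_eq_zero {H : M → Crn r n} (ha : IsAdapted α r e H p) (hi : i ≤ r) {m' : ℕ}
    (hm : m < m') : Csum α r i m' p (cderiv e m H p) = 0 :=
  Csum_eq_zero_of_lt α r p hm fun j hj => ha j (by omega) m

/-- For an adapted `H`, the vectors `K^{(m)}_i` formed with different coordinates are
proportional: the lower derivatives of `H` do not contribute. -/
lemma IsAdapted.exists_coord (h : IsCoordAt e p) (h' : IsCoordAt e' p) {H : M → Crn r n}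
    (hH : IsRegularAt e H p) (ha : IsAdapted α r e H p) (hi : i ≤ r) (m : ℕ) :
    ∃ c : ℂ, Csum α r i m p (cderiv e' m H p) = c • Csum α r i m p (cderiv e m H p) := by
  obtain ⟨c, hc⟩ := exists_cderiv_coord h h' hH m
  refine ⟨c m, ?_⟩
  rw [hc, map_sum, Finset.sum_range_succ, map_smul, Finset.sum_eq_zero, zero_add]
  intro k hk
  rw [map_smul, ha.Csum_eq_zero hi (Finset.mem_range.1 hk), smul_zero]

lemma IsAdapted.congr_coord (h : IsCoordAt e p) (h' : IsCoordAt e' p) {H : M → Crn r n}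
    (hH : IsRegularAt e H p) (ha : IsAdapted α r e H p) : IsAdapted α r e' H p := by
  intro j hj m
  obtain ⟨c, hc⟩ := ha.exists_coord h h' hH hj.le m
  rw [hc]
  exact Submodule.smul_mem _ _ (ha j hj m)

lemma Az_Csum_cderiv (hu : IsUnitonSequence φ₀ α i) (h : IsCoordAt e p) {H : M → Crn r n}
    (hH : IsRegularAt e H p)
    (h0 : ∀ᶠ q in 𝓝 p, Csum α r i (m + 1) q (cderiv e m H q) = 0) :
    Az e (phi φ₀ α i) p (Csum α r i m p (cderiv e m H p)) =
      -Csum α r i (m + 1) p (cderiv e (m + 1) H p) := by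
  rw [Az_Csum_eq_neg hu h (.of_isRegularAt (hH.cderiv h m)) h0, dz_cderiv h hH]

end DerivCsum

/-! ### Bundles spanned by generating functions form covering sequences of unitons -/

section Generated

variable {M : Type*} [TopologicalSpace M] [ChartedSpace ℂ M] {n : ℕ}

/-- The bundles `α_1, …, α_r` are spanned, off a closed discrete set, by the `K^{(k)}_i` formed
from those members of the family `𝓗` that are holomorphic at the point. Both ways of giving the
bundles by meromorphic data are of this form. -/
def IsGeneratedBy (z : M → OpenPartialHomeomorph M ℂ) (α : ℕ → Subbundle M (Cn n)) (r : ℕ)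
    (𝓗 : Set (M → Crn r n)) : Prop :=
  ∀ i < r, ∀ᶠ p in codiscrete M, (α (i + 1)).fiber p =
    Submodule.span ℂ {v | ∃ H ∈ 𝓗, ∃ k ≤ i, IsRegularAt (z p) H p ∧
      v = Csum α r i k p (cderiv (z p) k H p)}

variable {z : M → OpenPartialHomeomorph M ℂ} {α : ℕ → Subbundle M (Cn n)} {r : ℕ}
  {𝓗 : Set (M → Crn r n)} {e : OpenPartialHomeomorph M ℂ} {p : M}

lemma IsGeneratedBy.eventually (hg : IsGeneratedBy z α r 𝓗) :
    ∀ᶠ p in codiscrete M, ∀ i < r, (α (i + 1)).fiber p =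
      Submodule.span ℂ {v | ∃ H ∈ 𝓗, ∃ k ≤ i, IsRegularAt (z p) H p ∧
        v = Csum α r i k p (cderiv (z p) k H p)} := by
  have : ∀ᶠ p in codiscrete M, ∀ i ∈ Finset.range r, (α (i + 1)).fiber p =
      Submodule.span ℂ {v | ∃ H ∈ 𝓗, ∃ k ≤ i, IsRegularAt (z p) H p ∧
        v = Csum α r i k p (cderiv (z p) k H p)} :=
    (Finset.eventually_all _).2 fun i hi => hg i (Finset.mem_range.1 hi)
  simpa only [Finset.mem_range] using this

/-- Where the bundles are spanned by the `K^{(k)}_i` with `k ≤ i`, the other `K^{(k)}_i` vanish. -/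
lemma isAdapted_of_fiber_eq (hp : ∀ i < r, (α (i + 1)).fiber p =
      Submodule.span ℂ {v | ∃ H ∈ 𝓗, ∃ k ≤ i, IsRegularAt (z p) H p ∧
        v = Csum α r i k p (cderiv (z p) k H p)}) {H : M → Crn r n} (hH : H ∈ 𝓗)
    (hr : IsRegularAt (z p) H p) : IsAdapted α r (z p) H p := by
  intro j hj m
  rcases le_or_gt m j with hm | hm
  · rw [hp j hj]
    exact Submodule.subset_span ⟨H, hH, m, hm, hr, rfl⟩
  · rw [Csum_eq_zero α r p hm]
    exact Submodule.zero_mem _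

/-- The covering condition holds since `π_i K^{(k)}_i = K^{(k)}_{i-1}`. -/
lemma IsGeneratedBy.covering (hg : IsGeneratedBy z α r 𝓗) : Covering α r := by
  intro l hl hlr
  obtain ⟨j, rfl⟩ : ∃ j, l = j + 1 + 1 := ⟨l - 2, by omega⟩
  filter_upwards [hg.eventually] with p hp
  rw [Nat.add_sub_cancel]
  refine le_antisymm ?_ ?_
  · rintro _ ⟨v, -, rfl⟩
    exact proj_apply_mem _ _ _
  · conv_lhs => rw [hp j (by omega)]
    refine Submodule.span_le.2 ?_
    rintro _ ⟨H, hH, k, hk, hr, rfl⟩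
    have ha := isAdapted_of_fiber_eq hp hH hr
    refine ⟨Csum α r (j + 1) k p (cderiv (z p) k H p), ha (j + 1) (by omega) k, ?_⟩
    exact (proj_Csum_succ α r p j k _).trans (proj_apply_of_mem _ _ (ha j (by omega) k))

variable [IsManifold 𝓘(ℂ) ω M] {φ₀ : Un n}

/-- Near a point where the bundles are spanned by the `K^{(k)}_i`, the uniton conditions need only
be checked on these: `D_z̄ K^{(k)}_i = 0` and `A_z K^{(k)}_i = -K^{(k+1)}_i`. -/
lemma isUnitonAt_of_generated (hz : ∀ p, IsCoordAt (z p) p) {i : ℕ} (hi : i < r)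
    (hu : IsUnitonSequence φ₀ α i) (h : IsCoordAt e p)
    (hp : ∀ᶠ q in 𝓝 p, ∀ i < r, (α (i + 1)).fiber q =
      Submodule.span ℂ {v | ∃ H ∈ 𝓗, ∃ k ≤ i, IsRegularAt (z q) H q ∧
        v = Csum α r i k q (cderiv (z q) k H q)}) :
    IsUnitonAt e (phi φ₀ α i) (α (i + 1)) p := by
  have key : ∀ v ∈ (α (i + 1)).fiber p,
      (α (i + 1)).projPerp p (Az e (phi φ₀ α i) p v) = 0 ∧
      ((α (i + 1)).projPerp p * Azbar e (phi φ₀ α i) p - dzbar e (α (i + 1)).projPerp p) v = 0 := by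
    intro v hv
    rw [hp.self_of_nhds i hi] at hv
    induction hv using Submodule.span_induction with
    | mem v hv =>
      obtain ⟨H, hH, k, -, hr, rfl⟩ := hv
      have hre : IsRegularAt e H p := hr.congr_coord (hz p) h
      have had : ∀ᶠ q in 𝓝 p, IsAdapted α r e H q := by
        filter_upwards [hp, hre.eventually h, h.eventually] with q hq hrq hcq
        have hrz := hrq.congr_coord hcq (hz q)
        exact (isAdapted_of_fiber_eq hq hH hrz).congr_coord (hz q) hcq hrz
      obtain ⟨c, hc⟩ := had.self_of_nhds.exists_coord h (hz p) hre hi.le k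
      have h0 : ∀ᶠ q in 𝓝 p, Csum α r i (k + 1) q (cderiv e k H q) = 0 :=
        had.mono fun q hq => hq.Csum_eq_zero hi.le (Nat.lt_succ_self k)
      have hs : SmoothAt e (cderiv e k H) p := .of_isRegularAt (hre.cderiv h k)
      rw [hc]
      simp only [map_smul]
      constructor
      · rw [Az_Csum_cderiv hu h hre h0, map_neg,
          (mem_fiber_iff _ _ _).1 (had.self_of_nhds i hi (k + 1)), neg_zero, smul_zero]
      · rw [← projPerp_Dzbar (σ := fun q => Csum α r i k q (cderiv e k H q)) h _
            ((smoothAt_Csum h r i k).clm_apply hs) (had.mono fun q hq => hq i hi k),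
          Dzbar_Csum hu h hs h0, dzbar_of_isRegularAt (hre.cderiv h k)]
        simp
    | zero => simp
    | add v w _ _ hv hw =>
      simp only [map_add, hv.1, hv.2, hw.1, hw.2, add_zero, and_self]
    | smul c v _ hv => simp only [map_smul, hv.1, hv.2, smul_zero, and_self]
  constructor
  · ext1 v
    exact (key _ (proj_apply_mem _ _ v)).1
  · ext1 v
    exact (key _ (proj_apply_mem _ _ v)).2

/-- The uniton conditions hold off a closed discrete set, hence everywhere by continuity. -/
lemma IsGeneratedBy.isUnitonSequence (hz : ∀ p, IsCoordAt (z p) p)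
    (hg : IsGeneratedBy z α r 𝓗) : IsUnitonSequence φ₀ α r := by
  suffices H : ∀ l ≤ r, IsUnitonSequence φ₀ α l from H r le_rfl
  intro l
  induction l with
  | zero => intro _ j h1 h2; omega
  | succ l ih =>
    intro hl
    have hu := ih (by omega)
    intro j h1 h2
    rcases Nat.lt_or_ge j (l + 1) with hj | hj
    · exact hu j h1 (by omega)
    obtain rfl : j = l + 1 := le_antisymm h2 hj
    rw [Nat.add_sub_cancel]
    refine isUniton_iff.2 ⟨isHarmonic_phi hu, fun e p h => ?_⟩
    have hne := eventually_codiscrete_iff.1 (eventually_codiscrete_nhds hg.eventually) p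
    have hall : ∀ᶠ q in 𝓝[≠] p, IsUnitonAt e (phi φ₀ α l) (α (l + 1)) q := by
      filter_upwards [hne, nhdsWithin_le_nhds h.eventually] with q hq hqe
      exact isUnitonAt_of_generated hz (by omega) hu hqe hq
    have hφ := smoothAt_phi (α := α) h φ₀ l
    have hP := smoothAt_projPerp h (α (l + 1))
    have hπ := smoothAt_proj h (α (l + 1))
    constructor
    · exact ((hP.mul (smoothAt_Az h hφ)).mul hπ).eq_zero_of_punctured h (hall.mono fun q hq => hq.1)
    · exact (((hP.mul (smoothAt_Azbar h hφ)).sub (hP.wirt h Complex.I)).mul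
        hπ).eq_zero_of_punctured h (hall.mono fun q hq => hq.2)

end Generated

/-! ### Arrays and bundles as generating families -/

section Families

set_option linter.unusedSectionVars false

variable {M : Type*} [TopologicalSpace M] [ChartedSpace ℂ M] {n : ℕ}
variable {z : M → OpenPartialHomeomorph M ℂ} {α : ℕ → Subbundle M (Cn n)} {r : ℕ}
  {e : OpenPartialHomeomorph M ℂ} {p : M}

/-- The `j`-th column of an array, as a function with values in `ℂ^{rn}`. -/
def column (r : ℕ) (H : ℕ → Fin n → M → Cn n) (j : Fin n) (p : M) : Crn r n :=
  WithLp.toLp 2 fun s : Fin r => H s j p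

lemma K_comp_column (H : ℕ → Fin n → M → Cn n) (j : Fin n) {i : ℕ} (hi : i < r) (k : ℕ) :
    K α e (comp (column r H j)) i k p = K α e (fun t => H t j) i k p := by
  have : ∀ s : Fin r, comp (column r H j) s = H s j := fun s => by
    funext q; simp [comp, column]
  simp only [K_eq_sum α r p e _ hi, this]

lemma isRegularAt_column {H : ℕ → Fin n → M → Cn n} {j : Fin n}
    (h : ∀ s : Fin r, IsRegularAt e (H s j) p) : IsRegularAt e (column r H j) p := by
  have h1 : AnalyticAt ℂ (fun w (s : Fin r) => H s j (e.symm w)) (e p) := AnalyticAt.pi h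
  exact ((PiLp.continuousLinearEquiv 2 ℂ (fun _ : Fin r => Cn n)).symm :
    (∀ _ : Fin r, Cn n) →L[ℂ] Crn r n).analyticAt _ |>.comp h1

variable [IsManifold 𝓘(ℂ) ω M]

lemma givenByArray_iff (hz : ∀ p, IsCoordAt (z p) p) {H : ℕ → Fin n → M → Cn n}
    (hH : ∀ i < r, ∀ j, IsMeromorphic (H i j)) :
    GivenByArray z α r H ↔ IsGeneratedBy z α r (Set.range (column r H)) := by
  have hreg : ∀ᶠ p in codiscrete M, ∀ j, IsRegularAt (z p) (column r H j) p := by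
    have : ∀ᶠ p in codiscrete M, ∀ j, ∀ s : Fin r, IsRegularAt (z p) (H s j) p :=
      eventually_all.2 fun j => eventually_all.2 fun s => (hH s s.2 j).eventually_isRegularAt hz
    filter_upwards [this] with p hp j using isRegularAt_column (hp j)
  refine forall₂_congr fun i hi => eventually_congr ?_
  filter_upwards [hreg] with p hp
  suffices hset : {v | ∃ (j : Fin n) (k : ℕ), k ≤ i ∧ v = K α (z p) (fun t => H t j) i k p} =
      {v | ∃ G ∈ Set.range (column r H), ∃ k ≤ i, IsRegularAt (z p) G p ∧
        v = Csum α r i k p (cderiv (z p) k G p)} by rw [hset]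
  ext v
  constructor
  · rintro ⟨j, k, hk, rfl⟩
    refine ⟨_, ⟨j, rfl⟩, k, hk, hp j, ?_⟩
    rw [← K_eq_Csum α r p (hp j) k hi, K_comp_column H j hi]
  · rintro ⟨_, ⟨j, rfl⟩, k, hk, -, rfl⟩
    refine ⟨j, k, hk, ?_⟩
    rw [← K_eq_Csum α r p (hp j) k hi, K_comp_column H j hi]

lemma givenByBundle_iff {B : Subbundle M (Crn r n)} :
    GivenByBundle z α r B ↔ IsGeneratedBy z α r {H | B.IsMeromorphicSection H} := by
  refine forall₂_congr fun i hi => eventually_congr (.of_forall fun p => ?_)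
  suffices hspan : (⨆ k ∈ Finset.range (i + 1), Submodule.span ℂ {v | ∃ H : M → Crn r n,
      B.IsMeromorphicSection H ∧ IsRegularAt (z p) H p ∧ v = K α (z p) (comp H) i k p}) =
      Submodule.span ℂ {v | ∃ G ∈ {H | B.IsMeromorphicSection H}, ∃ k ≤ i, IsRegularAt (z p) G p ∧
        v = Csum α r i k p (cderiv (z p) k G p)} by rw [hspan]
  refine le_antisymm (iSup₂_le fun k hk => Submodule.span_mono ?_) (Submodule.span_le.2 ?_)
  · rintro _ ⟨H, hH, hr, rfl⟩
    exact ⟨H, hH, k, Nat.lt_succ_iff.1 (Finset.mem_range.1 hk), hr, K_eq_Csum α r p hr k hi⟩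
  · rintro _ ⟨H, hH, k, hk, hr, rfl⟩
    refine Submodule.mem_iSup_of_mem k (Submodule.mem_iSup_of_mem
      (Finset.mem_range.2 (Nat.lt_succ_iff.2 hk)) (Submodule.subset_span ⟨H, hH, hr, ?_⟩))
    rw [K_eq_Csum α r p hr k hi]

end Families

/-! ### The holomorphic bundle attached to a sequence of unitons -/

section Solve

variable {M : Type*} [TopologicalSpace M] [ChartedSpace ℂ M] {n : ℕ}
variable (α : ℕ → Subbundle M (Cn n)) (r : ℕ) (p : M)

lemma projPerp_proj_apply (β : Subbundle M (Cn n)) (p : M) (v : Cn n) :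
    β.projPerp p (β.proj p v) = 0 :=
  (mem_fiber_iff _ _ _).1 (proj_apply_mem β p v)

lemma proj_add_projPerp_apply (β : Subbundle M (Cn n)) (p : M) (v : Cn n) :
    β.proj p v + β.projPerp p v = v := by
  rw [proj_eq]
  simp

lemma sum_C_succ (h : ℕ → Cn n) (i m : ℕ) :
    ∑ s ∈ Finset.range (i + 2), C α (i + 1) s p (h (m + s)) =
      ∑ s ∈ Finset.range (i + 1), C α i s p (h (m + s)) +
        (α (i + 1)).projPerp p (∑ s ∈ Finset.range (i + 1), C α i s p (h (m + 1 + s))) := by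
  have h1 : ∑ s ∈ Finset.range (i + 1), C α i s p (h (m + s)) =
      ∑ s ∈ Finset.range (i + 2), C α i s p (h (m + s)) := by
    rw [Finset.sum_range_succ _ (i + 1), C_eq_zero α p (Nat.lt_succ_self i)]
    simp
  rw [h1, Finset.sum_range_succ', Finset.sum_range_succ' _ (i + 1), C_zero, C_zero, map_sum,
    add_right_comm, ← Finset.sum_add_distrib]
  congr 1
  refine Finset.sum_congr rfl fun s _ => ?_
  rw [C_succ_succ, add_apply, endC_mul_apply, show m + 1 + s = m + (s + 1) by ring]

/-- The operators `h ↦ (h_m + P_i h_{m+1})_m` on sequences, with composites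
`h ↦ (∑_s C^i_s h_{m+s})_m`, are onto, even with the components `P_i h_0` prescribed. In terms of
`h = ∑ h_m ν^m` this inverts `1 + ν⁻¹ P` up to polar parts. -/
lemma exists_sequence (i : ℕ) (g w : ℕ → Cn n)
    (hw : ∀ j, (α (j + 1)).projPerp p (w j) = w j) :
    ∃ h : ℕ → Cn n, (∀ m, ∑ s ∈ Finset.range (i + 1), C α i s p (h (m + s)) = g m) ∧
      ∀ j < i, (α (j + 1)).projPerp p (∑ s ∈ Finset.range (j + 1), C α j s p (h s)) = w j := by
  induction i generalizing g with
  | zero => exact ⟨g, fun m => by simp [C_zero], fun j hj => absurd hj (by omega)⟩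
  | succ i ih =>
    -- `h'` solves `h' m + P h' (m + 1) = g m` and `P (h' 0) = w i`, where `P = π_{i+1}^⊥`: the
    -- `π`-component of `h' m` is that of `g m`, and the `P`-components are found recursively
    let h' : ℕ → Cn n := fun m => Nat.rec ((α (i + 1)).proj p (g 0) + w i)
      (fun m y => (α (i + 1)).proj p (g (m + 1)) + (α (i + 1)).projPerp p (g m - y)) m
    have h0 : h' 0 = (α (i + 1)).proj p (g 0) + w i := rfl
    have hs : ∀ m, h' (m + 1) =
      (α (i + 1)).proj p (g (m + 1)) + (α (i + 1)).projPerp p (g m - h' m) := fun m => rfl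
    have hPP : ∀ v, (α (i + 1)).projPerp p ((α (i + 1)).projPerp p v) =
        (α (i + 1)).projPerp p v := fun v => by
      rw [← endC_mul_apply, projPerp_mul_self]
    have hproj : ∀ m, (α (i + 1)).proj p (h' m) = (α (i + 1)).proj p (g m) := by
      intro m
      cases m with
      | zero =>
        rw [h0, map_add, ← hw i, proj_projPerp_apply, add_zero,
          proj_apply_of_mem _ _ (proj_apply_mem _ _ _)]
      | succ m =>
        rw [hs, map_add, proj_projPerp_apply, add_zero,
          proj_apply_of_mem _ _ (proj_apply_mem _ _ _)]
    obtain ⟨h, h1, h2⟩ := ih h'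
    refine ⟨h, fun m => ?_, fun j hj => ?_⟩
    · rw [sum_C_succ, h1, h1, hs, map_add, projPerp_proj_apply, zero_add, hPP, map_sub]
      nth_rewrite 1 [← proj_add_projPerp_apply (α (i + 1)) p (h' m)]
      rw [hproj]
      nth_rewrite 3 [← proj_add_projPerp_apply (α (i + 1)) p (g m)]
      abel
    · rcases Nat.lt_or_ge j i with hji | hji
      · exact h2 j hji
      · obtain rfl : j = i := by omega
        have := h1 0
        simp only [zero_add] at this
        rw [this, h0, map_add, projPerp_proj_apply, zero_add, hw]

lemma Csum_toLp (h : ℕ → Cn n) {j : ℕ} (hj : j < r) :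
    Csum α r j 0 p (WithLp.toLp 2 fun s : Fin r => h s) =
      ∑ s ∈ Finset.range (j + 1), C α j s p (h s) := by
  rw [Csum_apply]
  simp only [add_zero]
  rw [Fin.sum_univ_eq_sum_range (fun s => C α j s p (h s)) r]
  refine (Finset.sum_subset (Finset.range_mono hj) fun s _ hs => ?_).symm
  rw [C_eq_zero α p (by simpa using hs)]
  rfl

/-- The normal components of the vectors `∑_s C^j_s x_s`, `j < r`, are arbitrary. -/
lemma exists_projPerp_Csum_eq (w : ℕ → Cn n)
    (hw : ∀ j, (α (j + 1)).projPerp p (w j) = w j) :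
    ∃ x : Crn r n, ∀ j < r, (α (j + 1)).projPerp p (Csum α r j 0 p x) = w j := by
  obtain ⟨h, -, h2⟩ := exists_sequence α p r 0 w hw
  exact ⟨_, fun j hj => by rw [Csum_toLp α r p h hj]; exact h2 j hj⟩

/-- The map `x ↦ ∑_s C^r_s x_s` sends `kernelBundle α (r + 1)` onto `α_{r+1}` at every point. -/
lemma exists_Csum_eq {r : ℕ} {v : Cn n} (hv : v ∈ (α (r + 1)).fiber p) :
    ∃ x : Crn (r + 1) n, (∀ j < r + 1, Csum α (r + 1) j 0 p x ∈ (α (j + 1)).fiber p) ∧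
      Csum α (r + 1) r 0 p x = v := by
  obtain ⟨h, h1, h2⟩ := exists_sequence α p r (fun _ => v) 0 (fun j => map_zero _)
  have h3 : Csum α (r + 1) r 0 p (WithLp.toLp 2 fun s : Fin (r + 1) => h s) = v := by
    rw [Csum_toLp α (r + 1) p h (Nat.lt_succ_self r)]
    simpa using h1 0
  refine ⟨_, fun j hj => ?_, h3⟩
  rcases Nat.lt_or_ge j r with hjr | hjr
  · rw [Csum_toLp α (r + 1) p h hj, mem_fiber_iff]
    exact h2 j hjr
  · obtain rfl : j = r := by omega
    rwa [h3]

end Solve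

section Kernel

variable {M : Type*} [TopologicalSpace M] [ChartedSpace ℂ M] [IsManifold 𝓘(ℂ) ω M]
variable {F : Type*} [NormedAddCommGroup F] [InnerProductSpace ℂ F] [FiniteDimensional ℂ F]

lemma isUnit_of_forall_eq_zero {T : F →L[ℂ] F} (h : ∀ x, T x = 0 → x = 0) : IsUnit T := by
  have hk : LinearMap.ker (T : F →ₗ[ℂ] F) = ⊥ := (LinearMap.ker_eq_bot').2 h
  have h1 : IsUnit (T : F →ₗ[ℂ] F) := (LinearMap.isUnit_iff_ker_eq_bot _).2 hk
  obtain ⟨S, hS1, hS2⟩ := isUnit_iff_exists.1 h1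
  refine isUnit_iff_exists.2 ⟨LinearMap.toContinuousLinearMap S, ?_, ?_⟩
  · ext x
    exact LinearMap.congr_fun hS1 x
  · ext x
    exact LinearMap.congr_fun hS2 x

/-- The kernels of a smooth family of operators `Θ` form a smooth bundle if the ranges are the
kernels of smooth idempotents `R`. The projection onto `ker Θ` is
`1 - Θ^* (Θ Θ^* + R)⁻¹ Θ`. -/
lemma isSmooth_starProjection_ker {Θ R : M → F →L[ℂ] F}
    (hΘ : ∀ e p, IsCoordAt e p → SmoothAt e Θ p) (hR : ∀ e p, IsCoordAt e p → SmoothAt e R p)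
    (hRΘ : ∀ p x, R p (Θ p x) = 0) (hRR : ∀ p x, R p (R p x) = R p x)
    (hker : ∀ p y, R p y = 0 → ∃ x, Θ p x = y) :
    IsSmooth (fun p => (LinearMap.ker (Θ p : F →ₗ[ℂ] F)).starProjection) := by
  have hRG : ∀ p y, R p ((Θ p * star (Θ p) + R p) y) = R p y := fun p y => by
    have : (Θ p * star (Θ p) + R p) y = Θ p (star (Θ p) y) + R p y := rfl
    rw [this, map_add, hRΘ, hRR, zero_add]
  have hinner : ∀ p x y, inner ℂ (star (Θ p) y) x = inner ℂ y (Θ p x) := fun p x y => by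
    rw [ContinuousLinearMap.star_eq_adjoint, ContinuousLinearMap.adjoint_inner_left]
  have hunit : ∀ p, IsUnit (Θ p * star (Θ p) + R p) := by
    refine fun p => isUnit_of_forall_eq_zero fun y hy => ?_
    have h1 : R p y = 0 := by rw [← hRG, hy, map_zero]
    have h2 : Θ p (star (Θ p) y) = 0 := by
      have : (Θ p * star (Θ p) + R p) y = Θ p (star (Θ p) y) + R p y := rfl
      rw [this, h1, add_zero] at hy
      exact hy
    have h3 : star (Θ p) y = 0 := by
      rw [← inner_self_eq_zero (𝕜 := ℂ), hinner, h2, inner_zero_right]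
    obtain ⟨x, rfl⟩ := hker p y h1
    rw [← inner_self_eq_zero (𝕜 := ℂ), ← hinner, h3, inner_zero_left]
  have hform : ∀ p, (LinearMap.ker (Θ p : F →ₗ[ℂ] F)).starProjection =
      1 - star (Θ p) * (Ring.inverse (Θ p * star (Θ p) + R p) * Θ p) := by
    intro p
    ext1 x
    set y := Ring.inverse (Θ p * star (Θ p) + R p) (Θ p x) with hy
    have hGy : (Θ p * star (Θ p) + R p) y = Θ p x := by
      have h1 := congrArg (fun L : F →L[ℂ] F => L (Θ p x)) (Ring.mul_inverse_cancel _ (hunit p))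
      exact h1
    have hRy : R p y = 0 := by rw [← hRG, hGy, hRΘ]
    have hΘy : Θ p (star (Θ p) y) = Θ p x := by
      have : (Θ p * star (Θ p) + R p) y = Θ p (star (Θ p) y) + R p y := rfl
      rw [this, hRy, add_zero] at hGy
      exact hGy
    have hval : (1 - star (Θ p) * (Ring.inverse (Θ p * star (Θ p) + R p) * Θ p)) x =
      x - star (Θ p) y := rfl
    rw [hval]
    refine Submodule.eq_starProjection_of_mem_of_inner_eq_zero ?_ ?_
    · change Θ p (x - star (Θ p) y) = 0
      rw [map_sub, hΘy, sub_self]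
    · intro w hw
      have hw' : Θ p w = 0 := hw
      rw [sub_sub_cancel, hinner, hw', inner_zero_right]
  refine isSmooth_iff.2 fun e p h => ?_
  refine SmoothAt.congr h ?_ (.of_forall fun q => (hform q).symm)
  have hs := hΘ e p h
  have hG : SmoothAt e (fun q => Θ q * star (Θ q) + R q) p := (hs.mul hs.star).add (hR e p h)
  exact (SmoothAt.const _).sub (hs.star.mul ((hG.ringInverse h (hunit p)).mul hs))

end Kernel

section KernelBundle

variable {M : Type*} [TopologicalSpace M] [ChartedSpace ℂ M] {n : ℕ}
variable (α : ℕ → Subbundle M (Cn n)) (r : ℕ)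

/-- The inclusion of the `j`-th summand of `ℂ^{rn}`. -/
def summand (j : Fin r) : Cn n →L[ℂ] Crn r n :=
  ((PiLp.continuousLinearEquiv 2 ℂ (fun _ : Fin r => Cn n)).symm :
    (∀ _ : Fin r, Cn n) →L[ℂ] Crn r n) ∘L ContinuousLinearMap.single ℂ (fun _ : Fin r => Cn n) j

lemma sum_summand_apply (f : Fin r → Cn n) (k : Fin r) : (∑ j, summand r j (f j)) k = f k := by
  simp [summand, Pi.single_apply]

/-- The operator with components `π_{j+1}^⊥ ∑_s C^j_s x_s`, whose vanishing means that
`∑_s C^j_s x_s` lies in `α_{j+1}` for all `j < r`. -/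
def normalPart (p : M) : Crn r n →L[ℂ] Crn r n :=
  ∑ j : Fin r, summand r j ∘L (α (j + 1)).projPerp p ∘L Csum α r j 0 p

lemma normalPart_apply (p : M) (x : Crn r n) (j : Fin r) :
    normalPart α r p x j = (α (j + 1)).projPerp p (Csum α r j 0 p x) := by
  have : normalPart α r p x =
      ∑ j : Fin r, summand r j ((α (j + 1)).projPerp p (Csum α r j 0 p x)) := by
    simp [normalPart]
  rw [this, sum_summand_apply r (fun j : Fin r => (α (j + 1)).projPerp p (Csum α r j 0 p x))]

/-- The orthogonal projection of `ℂ^{rn}` onto `α_1 ⊕ ⋯ ⊕ α_r`. -/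
def diagProj (p : M) : Crn r n →L[ℂ] Crn r n :=
  ∑ j : Fin r, summand r j ∘L (α (j + 1)).proj p ∘L PiLp.proj 2 (fun _ : Fin r => Cn n) j

lemma diagProj_apply (p : M) (x : Crn r n) (j : Fin r) :
    diagProj α r p x j = (α (j + 1)).proj p (x j) := by
  have : diagProj α r p x = ∑ j : Fin r, summand r j ((α (j + 1)).proj p (x j)) := by
    simp [diagProj]
  rw [this, sum_summand_apply r (fun j : Fin r => (α (j + 1)).proj p (x j))]

variable [IsManifold 𝓘(ℂ) ω M]

/-- The bundle of those `x ∈ ℂ^{rn}` for which `∑_s C^j_s x_s` lies in `α_{j+1}` for all `j < r`.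
It is the Grassmannian model of the sequence `α_1, …, α_r`; its rank is locally constant, whether
or not the covering condition holds. -/
def kernelBundle : Subbundle M (Crn r n) where
  fiber p := LinearMap.ker (normalPart α r p : Crn r n →ₗ[ℂ] Crn r n)
  smooth := by
    refine isSmooth_starProjection_ker (R := diagProj α r) ?_ ?_ ?_ ?_ ?_
    · intro e p h
      have : normalPart α r = fun q => ∑ j : Fin r,
        summand r j ∘L (α (j + 1)).projPerp q ∘L Csum α r j 0 q := rfl
      rw [this]
      refine SmoothAt.sum fun j _ => SmoothAt.clm_comp (SmoothAt.const (summand r j)) ?_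
      exact (smoothAt_projPerp h _).clm_comp (smoothAt_Csum h r j 0)
    · intro e p h
      have : diagProj α r = fun q => ∑ j : Fin r, summand r j ∘L (α (j + 1)).proj q ∘L
        PiLp.proj 2 (𝕜 := ℂ) (fun _ : Fin r => Cn n) j := rfl
      rw [this]
      refine SmoothAt.sum fun j _ => SmoothAt.clm_comp (SmoothAt.const (summand r j)) ?_
      exact (smoothAt_proj h _).clm_comp (F := Crn r n) (SmoothAt.const _)
    · intro p x
      ext1 j
      rw [diagProj_apply, normalPart_apply, proj_projPerp_apply]
      rfl
    · intro p x
      ext1 j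
      rw [diagProj_apply, diagProj_apply, proj_apply_of_mem _ _ (proj_apply_mem _ _ _)]
    · intro p y hy
      have hy' : ∀ j : Fin r, (α (j + 1)).proj p (y j) = 0 := fun j => by
        rw [← diagProj_apply, hy]; rfl
      obtain ⟨x, hx⟩ := exists_projPerp_Csum_eq α r p
        (fun j => if h : j < r then y ⟨j, h⟩ else 0) fun j => by
          split_ifs with h
          · have h1 := proj_add_projPerp_apply (α (j + 1)) p (y ⟨j, h⟩)
            rwa [hy' ⟨j, h⟩, zero_add] at h1
          · exact map_zero _
      refine ⟨x, ?_⟩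
      ext1 j
      rw [normalPart_apply, hx j j.2, dif_pos j.2]

variable {α r}

lemma mem_kernelBundle {p : M} {x : Crn r n} : x ∈ (kernelBundle α r).fiber p ↔
    ∀ j < r, Csum α r j 0 p x ∈ (α (j + 1)).fiber p := by
  have h1 : x ∈ (kernelBundle α r).fiber p ↔ normalPart α r p x = 0 := Iff.rfl
  rw [h1]
  constructor
  · intro hx j hj
    rw [mem_fiber_iff, ← normalPart_apply α r p x ⟨j, hj⟩, hx]
    rfl
  · intro hx
    ext1 j
    rw [normalPart_apply]
    exact (mem_fiber_iff _ _ _).1 (hx j j.2)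

/-- The bundle attached to a sequence of unitons is holomorphic, since `∑_s C^j_s σ_s` is then a
section of `α_{j+1}` with `D_z̄`-derivative `∑_s C^j_s ∂_z̄ σ_s`. -/
lemma isHolomorphic_kernelBundle {φ₀ : Un n} (hu : IsUnitonSequence φ₀ α r) :
    (kernelBundle α r).IsHolomorphic := by
  intro σ hσ e p h
  have hmem : ∀ q, ∀ j < r, Csum α r j 0 q (σ q) ∈ (α (j + 1)).fiber q :=
    fun q => mem_kernelBundle.1 (hσ.2 q)
  refine mem_kernelBundle.2 fun j => ?_
  induction j using Nat.strong_induction_on with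
  | _ j ih =>
    intro hj
    have hsec : (α (j + 1)).IsSection fun q => Csum α r j 0 q (σ q) :=
      ⟨isSmooth_iff.2 fun e q hq => (smoothAt_Csum hq r j 0).clm_apply (hσ.1.smoothAt hq),
        fun q => hmem q j hj⟩
    have h1 := (hu (j + 1) (by omega) hj).holomorphic _ hsec e p h
    rw [Nat.add_sub_cancel, Dzbar_Csum (hu.mono hj.le) h (hσ.1.smoothAt h)
      (.of_forall fun q => Csum_succ_eq_zero α r q fun l hl => hmem q l (by omega)),
      Csum_succ_eq_zero α r p fun l hl => ih l hl (by omega), add_zero] at h1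
    exact h1

/-- Meromorphic sections of the bundle attached to a sequence of unitons generate elements of the
bundles `α_{j+1}`, since `A_z K^{(m)}_j = -K^{(m+1)}_j`. -/
lemma IsMeromorphicSection.isAdapted {φ₀ : Un n} (hu : IsUnitonSequence φ₀ α r)
    {H : M → Crn r n} (hH : (kernelBundle α r).IsMeromorphicSection H)
    {e : OpenPartialHomeomorph M ℂ} {p : M} (h : IsCoordAt e p) (hr : IsRegularAt e H p) :
    IsAdapted α r e H p := by
  have hmem := eventually_codiscrete_iff.1 hH.2
  have key : ∀ m, ∀ᶠ q in 𝓝 p, ∀ j < r,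
      Csum α r j m q (cderiv e m H q) ∈ (α (j + 1)).fiber q := by
    intro m
    induction m with
    | zero =>
      filter_upwards [hr.eventually h, h.eventually] with q hrq hq j hj
      have hc : ∀ᶠ q' in 𝓝 q, cderiv e 0 H q' = H q' := by
        filter_upwards [hq.eventually_left_inv] with q' hq'
        simp [cderiv, hq']
      rw [hc.self_of_nhds, mem_fiber_iff]
      have hs : SmoothAt e (fun q' => (α (j + 1)).projPerp q' (Csum α r j 0 q' (H q'))) q :=
        (smoothAt_projPerp hq _).clm_apply
          ((smoothAt_Csum hq r j 0).clm_apply (.of_isRegularAt hrq))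
      refine hs.eq_zero_of_punctured hq ((hmem q).mono fun q' hq' => ?_)
      exact (mem_fiber_iff _ _ _).1 (mem_kernelBundle.1 hq' j hj)
    | succ m ih =>
      filter_upwards [ih.eventually_nhds, hr.eventually h, h.eventually] with q hmq hrq hq j hj
      have h0 : ∀ᶠ q' in 𝓝 q, Csum α r j (m + 1) q' (cderiv e m H q') = 0 :=
        hmq.mono fun q' hq' => Csum_succ_eq_zero α r q' fun l hl => hq' l (by omega)
      have h1 := Az_Csum_cderiv (hu.mono hj.le) hq hrq h0
      have h2 := congrArg (fun L : EndC n => L (Csum α r j m q (cderiv e m H q)))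
        (hu.isUnitonAt hj hq).1
      beta_reduce at h2
      rw [endC_mul_apply, endC_mul_apply, proj_apply_of_mem _ _ (hmq.self_of_nhds j hj), h1,
        map_neg] at h2
      exact (mem_fiber_iff _ _ _).2 (neg_eq_zero.1 h2)
  exact fun j hj m => (key m).self_of_nhds j hj

end KernelBundle

/-! ### Meromorphic frames of holomorphic subbundles -/

section SkewProjection

set_option linter.unusedSectionVars false

variable {F : Type*} [NormedAddCommGroup F] [InnerProductSpace ℂ F] [FiniteDimensional ℂ F]

/-- For orthogonal projections `Q₀` and `Q`: `X` is the projection onto the range of `Q` along the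
kernel of `Q₀`. Such an `X` exists when these two subspaces are complementary. -/
structure IsSkewProjection (Q₀ Q X : F →L[ℂ] F) : Prop where
  range_le : Q * X = X
  left : Q₀ * X = Q₀
  fix : X * Q = Q
  right : X * Q₀ = X

lemma IsSkewProjection.unique {Q₀ Q X Y : F →L[ℂ] F} (hX : IsSkewProjection Q₀ Q X)
    (hY : IsSkewProjection Q₀ Q Y) : X = Y := by
  have h1 : X * Y = Y := by rw [← hY.range_le, ← mul_assoc, hX.fix]
  have h2 : X * Y = X := by
    conv_lhs => rw [← hX.right, mul_assoc, hY.left, hX.right]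
  rw [← h2, h1]

/-- Two orthogonal projections `Q₀`, `Q` such that `Q₀ Q + (1 - Q₀) (1 - Q)` is invertible are
transversal. -/
lemma isSkewProjection_of_isUnit {Q₀ Q : F →L[ℂ] F} (h0 : Q₀ * Q₀ = Q₀) (h1 : Q * Q = Q)
    (hu : IsUnit (Q₀ * Q + (1 - Q₀) * (1 - Q))) :
    IsSkewProjection Q₀ Q (Ring.inverse (Q₀ * Q + (1 - Q₀) * (1 - Q)) * Q₀) := by
  set G := Q₀ * Q + (1 - Q₀) * (1 - Q) with hG
  have hGQ : G * Q = Q₀ * Q := by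
    rw [hG, add_mul, mul_assoc, mul_assoc, sub_mul 1 Q, one_mul, h1, sub_self, mul_zero, add_zero]
  have hQG : Q₀ * G = Q₀ * Q := by
    rw [hG, mul_add, ← mul_assoc, ← mul_assoc, mul_sub Q₀ 1 Q₀, mul_one, h0, sub_self, zero_mul,
      add_zero]
  have hl := Ring.inverse_mul_cancel G hu
  have hr := Ring.mul_inverse_cancel G hu
  -- `G` conjugates `Q` into `Q₀`
  have hconj : Ring.inverse G * Q₀ = Q * Ring.inverse G := by
    calc Ring.inverse G * Q₀ = Ring.inverse G * (Q₀ * G) * Ring.inverse G := by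
          rw [mul_assoc, mul_assoc, hr, mul_one]
      _ = Ring.inverse G * (G * Q) * Ring.inverse G := by rw [hQG, hGQ]
      _ = Q * Ring.inverse G := by rw [← mul_assoc, hl, one_mul]
  refine ⟨?_, ?_, ?_, ?_⟩
  · rw [hconj, ← mul_assoc, h1]
  · calc Q₀ * (Ring.inverse G * Q₀) = Q₀ * Q * Ring.inverse G := by rw [hconj, mul_assoc]
      _ = Q₀ := by rw [← hQG, mul_assoc, hr, mul_one]
  · rw [mul_assoc, ← hGQ, ← mul_assoc, hl, one_mul]
  · rw [mul_assoc, h0]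

lemma exists_orthonormal_starProjection (S : Submodule ℂ F) {k : ℕ}
    (hk : Module.finrank ℂ S = k) : ∃ a : Fin k → F, (∀ i, a i ∈ S) ∧
      (∀ i j, inner ℂ (a i) (a j) = if i = j then (1 : ℂ) else 0) ∧
      ∀ v, S.starProjection v = ∑ i, inner ℂ (a i) v • a i := by
  subst hk
  let b := stdOrthonormalBasis ℂ S
  refine ⟨fun i => b i, fun i => (b i).2, fun i j => ?_, fun v => ?_⟩
  · have := orthonormal_iff_ite.1 b.orthonormal i j
    simpa using this
  · rw [b.starProjection_eq_sum_rankOne]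
    simp

/-- The matrix criterion for transversality: `N` is a projection onto the range of `Q` parallel to
some complement, `a` is a basis of the range of `Q₁`, and `c` one of the range of `Q₀`. The
skew projection along `ker Q₀` is obtained by inverting the matrix with entries
`⟪c_j, N a_i⟫`. -/
lemma exists_isSkewProjection_iff {Q₀ Q₁ Q N : F →L[ℂ] F} {k : ℕ} {a c : Fin k → F}
    (hN : IsSkewProjection Q₁ Q N)
    (ha : ∀ i j, inner ℂ (a i) (a j) = if i = j then (1 : ℂ) else 0)
    (hQ₁ : ∀ v, Q₁ v = ∑ i, inner ℂ (a i) v • a i)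
    (hc : ∀ i j, inner ℂ (c i) (c j) = if i = j then (1 : ℂ) else 0)
    (hQ₀ : ∀ v, Q₀ v = ∑ i, inner ℂ (c i) v • c i)
    {m : Matrix (Fin k) (Fin k) ℂ} (hm : ∀ j i, m j i = inner ℂ (c j) (N (a i))) :
    (m.det ≠ 0 → IsSkewProjection Q₀ Q (m.det⁻¹ • ∑ i, ∑ j, m.adjugate i j •
      (N * InnerProductSpace.rankOne ℂ (a i) (c j)))) ∧
    ((∃ X, IsSkewProjection Q₀ Q X) → m.det ≠ 0) := by
  have hap : ∀ {A B : F →L[ℂ] F}, A = B ↔ ∀ v, A v = B v := ContinuousLinearMap.ext_iff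
  have hmul : ∀ (A B : F →L[ℂ] F) v, (A * B) v = A (B v) := fun _ _ _ => rfl
  have hQa : ∀ l, Q₁ (a l) = a l := fun l => by
    rw [hQ₁]; simp [ha]
  constructor
  · intro hdet
    set X := m.det⁻¹ • ∑ i, ∑ j, m.adjugate i j • (N * InnerProductSpace.rankOne ℂ (a i) (c j))
      with hX
    have hXv : ∀ v, X v = m.det⁻¹ • ∑ i, ∑ j, (m.adjugate i j * inner ℂ (c j) v) • N (a i) := by
      intro v
      simp [hX, hmul, smul_smul]
    have hcX : ∀ l v, inner ℂ (c l) (X v) = inner ℂ (c l) v := by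
      intro l v
      have h1 : ∀ j, ∑ i, m l i * m.adjugate i j = if l = j then m.det else 0 := fun j => by
        have := congrFun (congrFun m.mul_adjugate l) j
        rw [Matrix.mul_apply] at this
        rw [this, Matrix.smul_apply, Matrix.one_apply]
        split_ifs <;> simp
      rw [hXv, inner_smul_right]
      simp only [inner_sum, inner_smul_right, ← hm]
      rw [Finset.sum_comm]
      have h2 : ∀ j, ∑ i, m.adjugate i j * inner ℂ (c j) v * m l i =
          (if l = j then m.det else 0) * inner ℂ (c j) v := fun j => by
        rw [← h1, Finset.sum_mul]
        exact Finset.sum_congr rfl fun i _ => by ring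
      simp only [h2, ite_mul, zero_mul, Finset.sum_ite_eq, Finset.mem_univ, if_true]
      rw [← mul_assoc, inv_mul_cancel₀ hdet, one_mul]
    have hXN : ∀ l, X (N (a l)) = N (a l) := by
      intro l
      have h1 : ∀ i, ∑ j, m.adjugate i j * m j l = if i = l then m.det else 0 := fun i => by
        have := congrFun (congrFun m.adjugate_mul i) l
        rw [Matrix.mul_apply] at this
        rw [this, Matrix.smul_apply, Matrix.one_apply]
        split_ifs <;> simp
      rw [hXv]
      simp only [← hm, ← Finset.sum_smul, h1, ite_smul, zero_smul, Finset.sum_ite_eq',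
        Finset.mem_univ, if_true]
      rw [smul_smul, inv_mul_cancel₀ hdet, one_smul]
    refine ⟨?_, ?_, ?_, ?_⟩
    · refine hap.2 fun v => ?_
      have hQN : ∀ u, Q (N u) = N u := fun u => by rw [← hmul, hN.range_le]
      rw [hmul, hXv, map_smul, map_sum]
      simp only [map_sum, map_smul, hQN]
    · refine hap.2 fun v => ?_
      rw [hmul, hQ₀, hQ₀]
      simp only [hcX]
    · refine hap.2 fun v => ?_
      have h1 : Q v = N (Q₁ (Q v)) := by rw [← hmul, hN.right, ← hmul, hN.fix]
      rw [hmul, h1, hQ₁, map_sum, map_sum]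
      simp only [map_smul, hXN]
    · refine hap.2 fun v => ?_
      have h1 : ∀ l, inner ℂ (c l) (Q₀ v) = inner ℂ (c l) v := fun l => by
        rw [hQ₀]; simp [hc]
      rw [hmul, hXv, hXv]
      simp only [h1]
  · rintro ⟨X, hX⟩ hdet
    obtain ⟨y, hy0, hy⟩ := Matrix.exists_mulVec_eq_zero_iff.2 hdet
    have hu : N (∑ i, y i • a i) = 0 := by
      set u := N (∑ i, y i • a i) with hu
      have h1 : ∀ j, inner ℂ (c j) u = 0 := fun j => by
        have := congrFun hy j
        simp only [Matrix.mulVec, dotProduct, hm, Pi.zero_apply] at this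
        rw [hu, map_sum, inner_sum, ← this]
        simp [inner_smul_right, mul_comm]
      have h2 : Q₀ u = 0 := by rw [hQ₀]; simp [h1]
      have h3 : Q u = u := by rw [hu, ← hmul, hN.range_le]
      rw [← h3, ← hX.fix, hmul, h3, ← hX.right, hmul, h2, map_zero]
    have h1 : ∑ i, y i • a i = 0 := by
      have h2 : Q₁ (∑ i, y i • a i) = ∑ i, y i • a i := by simp [map_sum, hQa]
      rw [← h2, ← hN.left, hmul, hu, map_zero]
    refine hy0 (funext fun j => ?_)
    have h2 : inner ℂ (a j) (∑ i, y i • a i) = y j := by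
      simp [ha]
    rw [← h2, h1, inner_zero_right]
    rfl

open Classical in
/-- The projection onto the range of `Q` along the kernel of `Q₀`, and `0` if these are not
complementary. -/
def skewProjection (Q₀ Q : F →L[ℂ] F) : F →L[ℂ] F :=
  if h : ∃ X, IsSkewProjection Q₀ Q X then h.choose else 0

lemma IsSkewProjection.eq {Q₀ Q X : F →L[ℂ] F} (h : IsSkewProjection Q₀ Q X) :
    skewProjection Q₀ Q = X := by
  have he : ∃ X, IsSkewProjection Q₀ Q X := ⟨X, h⟩
  rw [skewProjection, dif_pos he]
  exact he.choose_spec.unique h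

end SkewProjection

section Frames

set_option linter.unusedSectionVars false

variable {M : Type*} [TopologicalSpace M] [ChartedSpace ℂ M] [IsManifold 𝓘(ℂ) ω M]
variable {F : Type*} [NormedAddCommGroup F] [InnerProductSpace ℂ F] [FiniteDimensional ℂ F]
variable {B : Subbundle M F} {e : OpenPartialHomeomorph M ℂ} {p : M}

lemma proj_mul_proj (B : Subbundle M F) (q : M) : B.proj q * B.proj q = B.proj q :=
  Submodule.isIdempotentElem_starProjection _

lemma Subbundle.proj_apply_eq_self (B : Subbundle M F) {q : M} {v : F} (h : v ∈ B.fiber q) :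
    B.proj q v = v :=
  Submodule.starProjection_eq_self_iff.2 h

lemma Subbundle.proj_mem (B : Subbundle M F) (q : M) (v : F) : B.proj q v ∈ B.fiber q :=
  Submodule.starProjection_apply_mem _ _

/-- A bundle is transversal, near `p`, to the orthogonal complement of its fibre at `p`. -/
lemma eventually_isUnit_skew (B : Subbundle M F) (p : M) : ∀ᶠ q in 𝓝 p,
    IsUnit (B.proj p * B.proj q + (1 - B.proj p) * (1 - B.proj q)) := by
  have h := isCoordAt_chartAt p
  have hc : ContinuousAt B.proj p := (B.smooth.smoothAt h).continuousAt h
  have hG : ContinuousAt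
      (fun q => B.proj p * B.proj q + (1 - B.proj p) * (1 - B.proj q)) p :=
    (continuousAt_const.mul hc).add (continuousAt_const.mul (continuousAt_const.sub hc))
  refine hG.eventually (Units.isOpen.mem_nhds ?_)
  have h1 : B.proj p * B.proj p + (1 - B.proj p) * (1 - B.proj p) = 1 := by
    rw [mul_sub, mul_one, sub_mul, one_mul, proj_mul_proj]
    abel
  change IsUnit (B.proj p * B.proj p + (1 - B.proj p) * (1 - B.proj p))
  rw [h1]
  exact isUnit_one

lemma eventually_isSkewProjection (B : Subbundle M F) (p : M) : ∀ᶠ q in 𝓝 p,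
    IsSkewProjection (B.proj p) (B.proj q) (skewProjection (B.proj p) (B.proj q)) := by
  filter_upwards [eventually_isUnit_skew B p] with q hq
  have h1 := isSkewProjection_of_isUnit (proj_mul_proj B p) (proj_mul_proj B q) hq
  rwa [h1.eq]

lemma eventually_finrank_eq (B : Subbundle M F) (p : M) : ∀ᶠ q in 𝓝 p,
    Module.finrank ℂ (B.fiber q) = Module.finrank ℂ (B.fiber p) := by
  filter_upwards [eventually_isSkewProjection B p] with q hq
  set N := skewProjection (B.proj p) (B.proj q)
  have hmul : ∀ (A A' : F →L[ℂ] F) v, (A * A') v = A (A' v) := fun _ _ _ => rfl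
  have hN : ∀ v, N v ∈ B.fiber q := fun v => by
    rw [← hq.range_le]; exact B.proj_mem q _
  refine le_antisymm ?_ ?_
  · refine LinearMap.finrank_le_finrank_of_injective
      (f := ((B.proj p : F →ₗ[ℂ] F).restrict fun v _ => B.proj_mem p v :
        B.fiber q →ₗ[ℂ] B.fiber p)) fun u v huv => ?_
    have h1 : B.proj p (u : F) = B.proj p (v : F) := congrArg Subtype.val huv
    have h2 : ∀ u : B.fiber q, N (B.proj p (u : F)) = u := fun u => by
      rw [← hmul, hq.right, ← B.proj_apply_eq_self u.2, ← hmul, hq.fix]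
    exact Subtype.ext (by rw [← h2 u, h1, h2 v])
  · refine LinearMap.finrank_le_finrank_of_injective
      (f := ((N : F →ₗ[ℂ] F).restrict fun v _ => hN v :
        B.fiber p →ₗ[ℂ] B.fiber q)) fun u v huv => ?_
    have h1 : N (u : F) = N (v : F) := congrArg Subtype.val huv
    have h2 : ∀ u : B.fiber p, B.proj p (N (u : F)) = u := fun u => by
      rw [← hmul, hq.left, B.proj_apply_eq_self u.2]
    exact Subtype.ext (by rw [← h2 u, h1, h2 v])

lemma finrank_fiber_eq [PreconnectedSpace M] (B : Subbundle M F) (p q : M) :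
    Module.finrank ℂ (B.fiber p) = Module.finrank ℂ (B.fiber q) :=
  ((IsLocallyConstant.iff_eventually_eq fun p => Module.finrank ℂ (B.fiber p)).2
    (eventually_finrank_eq B)).apply_eq_of_preconnectedSpace p q

lemma Subbundle.IsHolomorphic.proj_mul_dzbar (hB : B.IsHolomorphic) (h : IsCoordAt e p) :
    B.proj p * dzbar e B.proj p = dzbar e B.proj p := by
  ext1 v
  have hs : ∀ e p, IsCoordAt e p → SmoothAt e (fun q => B.proj q v) p := fun e p h =>
    SmoothAt.clm_apply (B.smooth.smoothAt h) (SmoothAt.const v)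
  have h1 := hB (fun q => B.proj q v) ⟨isSmooth_iff.2 hs, fun q => B.proj_mem q v⟩ e p h
  have h2 := wirt_clm_apply h Complex.I (f := B.proj) (B.smooth.smoothAt h)
    (SmoothAt.const (M := M) (e := e) (p := p) v)
  rw [wirt_const, map_zero, add_zero] at h2
  rw [dzbar_eq_wirt, h2, ← dzbar_eq_wirt] at h1
  exact B.proj_apply_eq_self h1

/-- A holomorphic subbundle `B` is, near `p`, the graph of a holomorphic map: the projection onto
`B_q` along the orthogonal complement of `B_p` depends holomorphically on `q`. -/
lemma Subbundle.IsHolomorphic.isRegularAt_skewProjection (hB : B.IsHolomorphic)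
    (h : IsCoordAt e p) :
    IsRegularAt e (fun q => skewProjection (B.proj p) (B.proj q)) p := by
  have hQs : ∀ q, IsCoordAt e q → SmoothAt e B.proj q := fun q hq => B.smooth.smoothAt hq
  have hskew := eventually_isSkewProjection B p
  have hsm : ∀ᶠ q in 𝓝 p, SmoothAt e (fun q => skewProjection (B.proj p) (B.proj q)) q := by
    filter_upwards [(eventually_isUnit_skew B p).eventually_nhds, h.eventually] with q hq hqc
    have hG : SmoothAt e
        (fun q => B.proj p * B.proj q + (1 - B.proj p) * (1 - B.proj q)) q :=
      ((SmoothAt.const _).mul (hQs q hqc)).add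
        ((SmoothAt.const _).mul ((SmoothAt.const _).sub (hQs q hqc)))
    refine SmoothAt.congr hqc
      ((hG.ringInverse hqc hq.self_of_nhds).mul (SmoothAt.const (B.proj p))) ?_
    filter_upwards [hq] with q' hq'
    exact (isSkewProjection_of_isUnit (proj_mul_proj B p) (proj_mul_proj B q') hq').eq.symm
  refine SmoothAt.isRegularAt h hsm ?_
  filter_upwards [hskew.eventually_nhds, hsm, h.eventually] with q hq hNs hqc
  set N := fun q => skewProjection (B.proj p) (B.proj q) with hN
  have h1 := wirt_mul hqc Complex.I (hQs q hqc) hNs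
  rw [wirt_congr hqc (hq.mono fun q' hq' => hq'.range_le)] at h1
  have h2 := wirt_mul hqc Complex.I (SmoothAt.const (B.proj p)) hNs
  rw [wirt_congr hqc (hq.mono fun q' hq' => hq'.left), wirt_const, zero_mul, zero_add] at h2
  have h3 := hB.proj_mul_dzbar hqc
  rw [dzbar_eq_wirt] at h3 ⊢
  have hq' := hq.self_of_nhds
  -- `∂_z̄ N` takes values in `B`
  have h4 : B.proj q * wirt Complex.I e N q = wirt Complex.I e N q := by
    rw [h1, mul_add, ← mul_assoc, h3, ← mul_assoc, proj_mul_proj]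
  calc wirt Complex.I e N q = N q * B.proj q * wirt Complex.I e N q := by rw [hq'.fix, h4]
    _ = N q * (B.proj p * wirt Complex.I e N q) := by
        rw [mul_assoc, h4, ← mul_assoc, hq'.right]
    _ = 0 := by rw [← h2, mul_zero]

lemma analyticAt_det {k : ℕ} {m : ℂ → Matrix (Fin k) (Fin k) ℂ} {w : ℂ}
    (hm : ∀ i j, AnalyticAt ℂ (fun v => m v i j) w) : AnalyticAt ℂ (fun v => (m v).det) w := by
  simp only [Matrix.det_apply']
  exact Finset.analyticAt_fun_sum _ fun σ _ =>
    analyticAt_const.mul (Finset.analyticAt_fun_prod _ fun i _ => hm _ _)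

lemma analyticAt_adjugate {k : ℕ} {m : ℂ → Matrix (Fin k) (Fin k) ℂ} {w : ℂ}
    (hm : ∀ i j, AnalyticAt ℂ (fun v => m v i j) w) (i j : Fin k) :
    AnalyticAt ℂ (fun v => (m v).adjugate i j) w := by
  simp only [Matrix.adjugate_apply]
  refine analyticAt_det fun a b => ?_
  by_cases h : a = j
  · subst h
    simp only [Matrix.updateRow_self]
    exact analyticAt_const
  · simp only [Matrix.updateRow_ne h]
    exact hm a b

/-- Near any point, the fibres of a holomorphic subbundle are either never complementary to a given
subspace, or complementary to it except at the point; in the second case the corresponding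
projection is meromorphic. -/
lemma Subbundle.IsHolomorphic.skewProjection_dichotomy (hB : B.IsHolomorphic) {b : M}
    (hrank : Module.finrank ℂ (B.fiber p) = Module.finrank ℂ (B.fiber b)) (h : IsCoordAt e p) :
    (∀ᶠ q in 𝓝 p, ¬∃ X, IsSkewProjection (B.proj b) (B.proj q) X) ∨
    ((∀ᶠ q in 𝓝[≠] p, ∃ X, IsSkewProjection (B.proj b) (B.proj q) X) ∧
      MeromorphicAt ((fun q => skewProjection (B.proj b) (B.proj q)) ∘ e.symm) (e p)) := by
  obtain ⟨a, -, ha, hQ₁⟩ := exists_orthonormal_starProjection (B.fiber p) hrank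
  obtain ⟨c, -, hc, hQ₀⟩ := exists_orthonormal_starProjection (B.fiber b) rfl
  set N := fun q => skewProjection (B.proj p) (B.proj q) with hN
  have hNr : IsRegularAt e N p := hB.isRegularAt_skewProjection h
  let m : M → Matrix (Fin _) (Fin _) ℂ := fun q j i => inner ℂ (c j) (N q (a i))
  have hma : ∀ j i, AnalyticAt ℂ (fun w => m (e.symm w) j i) (e p) := fun j i => by
    have h1 : AnalyticAt ℂ (fun w => (N ∘ e.symm) w (a i)) (e p) :=
      (ContinuousLinearMap.apply ℂ F (a i)).analyticAt _ |>.comp hNr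
    exact (innerSL ℂ (c j)).analyticAt _ |>.comp h1
  have hdet : AnalyticAt ℂ (fun w => (m (e.symm w)).det) (e p) := analyticAt_det hma
  have hiff : ∀ᶠ q in 𝓝 p, _ := (eventually_isSkewProjection B p).mono fun q hq =>
    exists_isSkewProjection_iff (m := m q) hq ha hQ₁ hc hQ₀ fun _ _ => rfl
  rcases hdet.eventually_eq_zero_or_eventually_ne_zero with h0 | h0
  · left
    filter_upwards [hiff, (e.continuousAt h.2).eventually h0, h.eventually_left_inv]
      with q hq hq0 hqi hX
    rw [hqi] at hq0
    exact hq.2 hX hq0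
  · right
    constructor
    · filter_upwards [nhdsWithin_le_nhds hiff, h.tendsto_nhdsNE.eventually h0,
        nhdsWithin_le_nhds h.eventually_left_inv] with q hq hq0 hqi
      rw [hqi] at hq0
      exact ⟨_, hq.1 hq0⟩
    · have hmer : MeromorphicAt (fun w => (m (e.symm w)).det⁻¹ • ∑ i, ∑ j,
          (m (e.symm w)).adjugate i j •
            (N (e.symm w) * InnerProductSpace.rankOne ℂ (a i) (c j))) (e p) := by
        refine MeromorphicAt.smul hdet.meromorphicAt.inv (AnalyticAt.meromorphicAt ?_)
        refine Finset.analyticAt_fun_sum _ fun i _ => Finset.analyticAt_fun_sum _ fun j _ => ?_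
        exact (analyticAt_adjugate hma i j).smul (AnalyticAt.mul hNr analyticAt_const)
      refine hmer.congr ?_
      filter_upwards [nhdsWithin_le_nhds (h.tendsto_symm.eventually hiff), h0] with w hw hw0
      exact ((hw.1 hw0).eq).symm

/-- A holomorphic subbundle `B` of a trivial bundle over a connected surface is complementary, off
a closed discrete set, to the orthogonal complement of its fibre at `b`, and the projection onto
`B` along this constant subspace is a meromorphic function. This supplies enough meromorphic
sections of `B`. -/
lemma Subbundle.IsHolomorphic.isMeromorphic_skewProjection [PreconnectedSpace M]
    (hB : B.IsHolomorphic) (b : M) :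
    IsMeromorphic (fun q => skewProjection (B.proj b) (B.proj q)) ∧
      ∀ᶠ q in codiscrete M,
        IsSkewProjection (B.proj b) (B.proj q) (skewProjection (B.proj b) (B.proj q)) := by
  set T : Set M := {p | ∀ᶠ q in 𝓝[≠] p, ∃ X, IsSkewProjection (B.proj b) (B.proj q) X} with hT
  have hdich := fun p => hB.skewProjection_dichotomy (finrank_fiber_eq B p b) (isCoordAt_chartAt p)
  have hopen : IsOpen T := by
    rw [isOpen_iff_mem_nhds]
    intro p hp
    have hp' : ∀ᶠ q in 𝓝[≠] p, ∃ X, IsSkewProjection (B.proj b) (B.proj q) X := hp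
    rw [eventually_nhdsWithin_iff] at hp'
    filter_upwards [hp'.eventually_nhds] with q hq
    rcases hdich q with h2 | ⟨h2, -⟩
    · by_cases hqp : q = p
      · rw [hqp]; exact hp
      · exact absurd (hq.self_of_nhds hqp) h2.self_of_nhds
    · exact h2
  have hclosed : IsClosed T := by
    rw [← isOpen_compl_iff, isOpen_iff_mem_nhds]
    intro p hp
    rcases hdich p with h1 | ⟨h1, -⟩
    · filter_upwards [h1.eventually_nhds] with q hq hqT
      have := (isCoordAt_chartAt q).neBot
      have hqT' : ∀ᶠ q in 𝓝[≠] q, ∃ X, IsSkewProjection (B.proj b) (B.proj q) X := hqT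
      obtain ⟨x, hx, hx'⟩ := (hqT'.and (nhdsWithin_le_nhds hq)).exists
      exact hx' hx
    · exact absurd h1 hp
  have hb : b ∈ T := nhdsWithin_le_nhds ((eventually_isSkewProjection B b).mono fun q hq => ⟨_, hq⟩)
  have huniv : T = Set.univ := IsClopen.eq_univ ⟨hclosed, hopen⟩ ⟨b, hb⟩
  have hall : ∀ p, ∀ᶠ q in 𝓝[≠] p, ∃ X, IsSkewProjection (B.proj b) (B.proj q) X := fun p => by
    have : p ∈ T := huniv ▸ Set.mem_univ p
    exact this
  refine ⟨isMeromorphic_of_forall_exists fun p => ⟨_, isCoordAt_chartAt p, ?_⟩,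
    eventually_codiscrete_iff.2 fun p => ?_⟩
  · rcases hdich p with h1 | ⟨-, h1⟩
    · have := (isCoordAt_chartAt p).neBot
      obtain ⟨q, hq, hq'⟩ := ((hall p).and (nhdsWithin_le_nhds h1)).exists
      exact absurd hq hq'
    · exact h1
  · filter_upwards [hall p] with q hq
    obtain ⟨X, hX⟩ := hq
    rwa [hX.eq]

end Frames

/-! ### Meromorphic generators of a sequence of unitons -/

section Generators

lemma _root_.ContinuousLinearMap.meromorphicAt_comp {E F : Type*} [NormedAddCommGroup E]
    [NormedSpace ℂ E] [NormedAddCommGroup F] [NormedSpace ℂ F] (L : E →L[ℂ] F) {f : ℂ → E} {w : ℂ}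
    (hf : MeromorphicAt f w) : MeromorphicAt (fun v => L (f v)) w := by
  obtain ⟨k, hk⟩ := hf
  refine ⟨k, ((L.analyticAt _).comp hk).congr (.of_forall fun v => ?_)⟩
  simp

set_option linter.unusedSectionVars false

variable {M : Type*} [TopologicalSpace M] [ChartedSpace ℂ M] {n r : ℕ}
variable {α β : ℕ → Subbundle M (Cn n)} {φ₀ : Un n}

lemma phi_congr {i : ℕ} (h : ∀ l, l ≤ i → α l = β l) : phi φ₀ α i = phi φ₀ β i := by
  induction i with
  | zero => rfl
  | succ i ih =>
    funext p
    simp only [phi]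
    rw [ih fun l hl => h l (by omega), h (i + 1) le_rfl]

lemma C_congr {i : ℕ} (h : ∀ l, l ≤ i → α l = β l) (s : ℕ) (p : M) : C α i s p = C β i s p := by
  induction i generalizing s with
  | zero =>
    cases s with
    | zero => rw [C_zero, C_zero]
    | succ s => rw [C_eq_zero α p (by omega), C_eq_zero β p (by omega)]
  | succ i ih =>
    have ih' := ih fun l hl => h l (by omega)
    cases s with
    | zero => rw [C_zero, C_zero]
    | succ s => rw [C_succ_succ, C_succ_succ, ih', ih', h (i + 1) le_rfl]

lemma Csum_congr {i : ℕ} (h : ∀ l, l ≤ i → α l = β l) (m : ℕ) (p : M) (x : Crn r n) :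
    Csum α r i m p x = Csum β r i m p x := by
  rw [Csum_apply, Csum_apply]
  exact Finset.sum_congr rfl fun s _ => by rw [C_congr h]

/-- The subbundle of rank zero. -/
def zeroBundle (M : Type*) [TopologicalSpace M] [ChartedSpace ℂ M] (n : ℕ) :
    Subbundle M (Cn n) where
  fiber _ := ⊥
  smooth := contMDiff_const

lemma isUniton_zeroBundle {φ : M → Un n} (h : IsHarmonic φ) : IsUniton φ (zeroBundle M n) := by
  have h0 : ∀ σ, (zeroBundle M n).IsSection σ → σ = fun _ => 0 := fun σ hσ =>
    funext fun p => (Submodule.mem_bot ℂ).1 (hσ.2 p)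
  refine ⟨h, fun σ hσ e p _ => ?_, fun σ hσ e p _ => ?_⟩
  · rw [h0 σ hσ, Dzbar, dzbar_eq_wirt, wirt_const, map_zero, add_zero]
    exact Submodule.zero_mem _
  · rw [h0 σ hσ, map_zero]
    exact Submodule.zero_mem _

variable [IsManifold 𝓘(ℂ) ω M]

/-- The last of the unitons `α_1, …, α_{r+1}` may be replaced by the zero bundle. -/
lemma isUnitonSequence_update (hu : IsUnitonSequence φ₀ α (r + 1)) :
    IsUnitonSequence φ₀ (Function.update α (r + 1) (zeroBundle M n)) (r + 1) := by
  intro l h1 h2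
  have hphi : phi φ₀ (Function.update α (r + 1) (zeroBundle M n)) (l - 1) = phi φ₀ α (l - 1) :=
    phi_congr fun k hk => Function.update_of_ne (by omega) _ _
  rw [hphi]
  rcases eq_or_ne l (r + 1) with rfl | hl
  · rw [Function.update_self]
    exact isUniton_zeroBundle (hu _ h1 h2).harmonic
  · rw [Function.update_of_ne hl]
    exact hu l h1 h2

lemma mem_kernelBundle_update {p : M} {x : Crn (r + 1) n} :
    x ∈ (kernelBundle (Function.update α (r + 1) (zeroBundle M n)) (r + 1)).fiber p ↔
      x ∈ (kernelBundle α (r + 1)).fiber p ∧ Csum α (r + 1) r 0 p x = 0 := by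
  have hup : ∀ j ≤ r, ∀ l ≤ j, Function.update α (r + 1) (zeroBundle M n) l = α l :=
    fun j hj l hl => Function.update_of_ne (by omega) _ _
  have hC : ∀ j ≤ r, Csum (Function.update α (r + 1) (zeroBundle M n)) (r + 1) j 0 p x =
      Csum α (r + 1) j 0 p x := fun j hj =>
    Csum_congr (hup j hj) 0 p x
  rw [mem_kernelBundle, mem_kernelBundle]
  constructor
  · intro h
    have h0 : Csum α (r + 1) r 0 p x = 0 := by
      have := h r (by omega)
      rw [Function.update_self, hC r le_rfl] at this
      exact (Submodule.mem_bot ℂ).1 this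
    refine ⟨fun j hj => ?_, h0⟩
    rcases eq_or_ne j r with rfl | hjr
    · rw [h0]; exact Submodule.zero_mem _
    · have := h j hj
      rwa [Function.update_of_ne (by omega), hC j (by omega)] at this
  · rintro ⟨h, h0⟩ j hj
    rw [hC j (by omega)]
    rcases eq_or_ne j r with rfl | hjr
    · rw [h0]; exact Submodule.zero_mem _
    · rw [Function.update_of_ne (by omega)]
      exact h j hj

lemma exists_span_range_eq {V : Type*} [AddCommGroup V] [Module ℂ V] [FiniteDimensional ℂ V]
    (U : Submodule ℂ V) {k : ℕ} (hk : Module.finrank ℂ U ≤ k) :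
    ∃ u : Fin k → V, Submodule.span ℂ (Set.range u) = U := by
  let b := Module.finBasis ℂ U
  refine ⟨fun i => if h : (i : ℕ) < Module.finrank ℂ U then (b ⟨i, h⟩ : V) else 0,
    le_antisymm (Submodule.span_le.2 ?_) fun v hv => ?_⟩
  · rintro _ ⟨i, rfl⟩
    dsimp only
    split_ifs
    exacts [(b _).2, U.zero_mem]
  · have h1 : v = ∑ i, b.repr ⟨v, hv⟩ i • (b i : V) := by
      have := congrArg U.subtype (b.sum_repr ⟨v, hv⟩)
      rw [map_sum] at this
      exact this.symm
    rw [h1]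
    refine Submodule.sum_mem _ fun i _ => Submodule.smul_mem _ _ (Submodule.subset_span ?_)
    exact ⟨⟨i, i.2.trans_le hk⟩, by simp⟩

/-- The `n` columns: meromorphic sections of `kernelBundle α (r + 1)` which generate, off a closed
discrete set, the last uniton. They arise from a basis `u` of a complement, in the fibre at a point
`b`, of the subbundle belonging to `α_1, …, α_r, 0`. -/
lemma exists_meromorphicSections [ConnectedSpace M] (hu : IsUnitonSequence φ₀ α (r + 1)) :
    ∃ H : Fin n → M → Crn (r + 1) n,
      (∀ j, (kernelBundle α (r + 1)).IsMeromorphicSection (H j)) ∧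
      ∀ᶠ p in codiscrete M, (α (r + 1)).fiber p ≤
        Submodule.span ℂ (Set.range fun j => Csum α (r + 1) r 0 p (H j p)) := by
  obtain ⟨b⟩ : Nonempty M := inferInstance
  set α' := Function.update α (r + 1) (zeroBundle M n) with hα'
  set B := kernelBundle α (r + 1) with hB
  set B' := kernelBundle α' (r + 1) with hB'
  have hle : ∀ p, B'.fiber p ≤ B.fiber p := fun p x hx => (mem_kernelBundle_update.1 hx).1
  obtain ⟨hmer, hN⟩ := (isHolomorphic_kernelBundle hu).isMeromorphic_skewProjection b
  obtain ⟨-, hN'⟩ :=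
    (isHolomorphic_kernelBundle (isUnitonSequence_update hu)).isMeromorphic_skewProjection b
  let U := B.fiber b ⊓ (B'.fiber b)ᗮ
  have hU : Module.finrank ℂ U ≤ n := by
    have h1 : Function.Injective
        ((Csum α (r + 1) r 0 b : Crn (r + 1) n →ₗ[ℂ] Cn n).domRestrict U) := by
      refine (injective_iff_map_eq_zero _).2 fun x hx => Subtype.ext ?_
      have h2 : (x : Crn (r + 1) n) ∈ B'.fiber b := mem_kernelBundle_update.2 ⟨x.2.1, hx⟩
      exact inner_self_eq_zero.1 (x.2.2 x h2)
    simpa using LinearMap.finrank_le_finrank_of_injective h1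
  obtain ⟨u, hspan⟩ := exists_span_range_eq U hU
  refine ⟨fun j p => skewProjection (B.proj b) (B.proj p) (u j), fun j => ⟨?_, ?_⟩, ?_⟩
  · intro e p h
    exact (ContinuousLinearMap.apply ℂ (Crn (r + 1) n) (u j)).meromorphicAt_comp (hmer e p h)
  · filter_upwards [hN] with p hp
    rw [← hp.range_le]
    exact B.proj_mem p _
  · filter_upwards [hN, hN'] with p hp hp'
    set N := skewProjection (B.proj b) (B.proj p)
    set N' := skewProjection (B'.proj b) (B'.proj p)
    have hmul : ∀ (S T : Crn (r + 1) n →L[ℂ] Crn (r + 1) n) v, (S * T) v = S (T v) :=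
      fun _ _ _ => rfl
    intro v hv
    obtain ⟨x, hx, rfl⟩ := exists_Csum_eq α p hv
    have hxB : x ∈ B.fiber p := mem_kernelBundle.2 hx
    have hx' : N' x ∈ B'.fiber p := by
      rw [← hp'.range_le]; exact B'.proj_mem p _
    -- subtracting `N' x` moves `x` into the orthogonal complement of `B'_b`
    set y := x - N' x with hy
    have hyB : y ∈ B.fiber p := Submodule.sub_mem _ hxB (hle p hx')
    have hy0 : B'.proj b y = 0 := by
      rw [hy, map_sub, ← hmul, hp'.left, sub_self]
    have hyN : y = N (B.proj b y) := by
      rw [← hmul, hp.right, ← B.proj_apply_eq_self hyB, ← hmul, hp.fix]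
    have hyU : B.proj b y ∈ U := by
      refine ⟨B.proj_mem b y, fun w hw => ?_⟩
      have h1 : B.proj b w = w := B.proj_apply_eq_self (hle b hw)
      have h2 : y ∈ (B'.fiber b)ᗮ := (Submodule.starProjection_apply_eq_zero_iff _).1 hy0
      rw [← h2 w hw]
      nth_rw 2 [← h1]
      exact (Submodule.inner_starProjection_left_eq_right _ _ _).symm
    have hxy : Csum α (r + 1) r 0 p x = Csum α (r + 1) r 0 p y := by
      rw [hy, map_sub, (mem_kernelBundle_update.1 hx').2, sub_zero]
    rw [hxy, hyN]
    rw [← hspan] at hyU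
    let T : Crn (r + 1) n →L[ℂ] Cn n := Csum α (r + 1) r 0 p ∘L N
    have h3 := Submodule.mem_map_of_mem (f := (T : Crn (r + 1) n →ₗ[ℂ] Cn n)) hyU
    rw [Submodule.map_span, ← Set.range_comp] at h3
    exact h3

/-- By the covering condition, sections of `kernelBundle α (r + 1)` which generate the last uniton
generate all of them. -/
lemma isGeneratedBy_of_covering {z : M → OpenPartialHomeomorph M ℂ} (hz : ∀ p, IsCoordAt (z p) p)
    (hu : IsUnitonSequence φ₀ α (r + 1)) (hc : Covering α (r + 1)) {H : Fin n → M → Crn (r + 1) n}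
    (hspan : ∀ᶠ p in codiscrete M, (α (r + 1)).fiber p ≤
      Submodule.span ℂ (Set.range fun j => Csum α (r + 1) r 0 p (H j p)))
    {𝓗 : Set (M → Crn (r + 1) n)} (hH : ∀ j, H j ∈ 𝓗)
    (h𝓗 : ∀ G ∈ 𝓗, (kernelBundle α (r + 1)).IsMeromorphicSection G) :
    IsGeneratedBy z α (r + 1) 𝓗 := by
  have hc' : ∀ᶠ p in codiscrete M, ∀ i ∈ Finset.range r,
      ((α (i + 2)).fiber p).map ((α (i + 1)).proj p : Cn n →ₗ[ℂ] Cn n) = (α (i + 1)).fiber p :=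
    (Finset.eventually_all _).2 fun i hi =>
      hc (i + 2) (by omega) (by have := Finset.mem_range.1 hi; omega)
  have hmem : ∀ᶠ p in codiscrete M, ∀ j, H j p ∈ (kernelBundle α (r + 1)).fiber p :=
    eventually_all.2 fun j => (h𝓗 _ (hH j)).2
  have hreg : ∀ᶠ p in codiscrete M, ∀ j, IsRegularAt (z p) (H j) p :=
    eventually_all.2 fun j => (h𝓗 _ (hH j)).1.eventually_isRegularAt hz
  intro i hi
  filter_upwards [hc', hmem, hreg, hspan] with p hcp hmp hrp hsp
  refine le_antisymm ?_ (Submodule.span_le.2 ?_)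
  · have key : ∀ d i, i + d = r → (α (i + 1)).fiber p ≤
        Submodule.span ℂ (Set.range fun j => Csum α (r + 1) i 0 p (H j p)) := by
      intro d
      induction d with
      | zero => rintro i rfl; exact hsp
      | succ d ih =>
        intro i hid
        rw [← hcp i (Finset.mem_range.2 (by omega))]
        refine (Submodule.map_mono (ih (i + 1) (by omega))).trans ?_
        rw [Submodule.map_span, ← Set.range_comp]
        refine Submodule.span_mono ?_
        rintro _ ⟨j, rfl⟩
        refine ⟨j, ?_⟩
        have h1 := proj_Csum_succ α (r + 1) p i 0 (H j p)
        rw [proj_apply_of_mem _ _ (mem_kernelBundle.1 (hmp j) i (by omega))] at h1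
        exact h1.symm
    refine (key (r - i) i (by omega)).trans (Submodule.span_mono ?_)
    rintro _ ⟨j, rfl⟩
    refine ⟨H j, hH j, 0, Nat.zero_le _, hrp j, ?_⟩
    rw [cderiv, iteratedDeriv_zero, Function.comp_apply, (hz p).left_inv]
  · rintro _ ⟨G, hG, k, -, hr, rfl⟩
    exact IsMeromorphicSection.isAdapted hu (h𝓗 G hG) (hz p) hr i hi k

lemma isMeromorphic_comp {H : M → Crn r n} (hH : IsMeromorphic H) (i : ℕ) :
    IsMeromorphic (comp H i) := by
  intro e p h
  by_cases hi : i < r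
  · have h1 := (PiLp.proj 2 (fun _ : Fin r => Cn n) ⟨i, hi⟩ :
      Crn r n →L[ℂ] Cn n).meromorphicAt_comp (hH e p h)
    refine h1.congr (.of_forall fun w => ?_)
    simp [comp, hi]
  · have h1 : comp H i ∘ e.symm = fun _ => 0 := by
      funext w; simp [comp, hi]
    rw [h1]
    exact MeromorphicAt.const 0 _

lemma column_comp (H : Fin n → M → Crn r n) : column r (fun i j => comp (H j) i) = H := by
  funext j p
  ext s : 1
  simp [column, comp]

end Generators

end CoveringUnitons

end

theorem mainTheorem3 {M : Type*} [TopologicalSpace M] [T2Space M] [ConnectedSpace M]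
    [ChartedSpace ℂ M] [IsManifold 𝓘(ℂ) ω M]
    (z : M → OpenPartialHomeomorph M ℂ) (hz : ∀ p, CoveringUnitons.IsCoordAt (z p) p)
    (n r : ℕ) (hn : 1 ≤ n) (hr : 1 ≤ r) (φ₀ : CoveringUnitons.Un n)
    (α : ℕ → CoveringUnitons.Subbundle M (CoveringUnitons.Cn n)) :
    List.TFAE [
      CoveringUnitons.IsUnitonSequence φ₀ α r ∧ CoveringUnitons.Covering α r,
      ∃ H : ℕ → Fin n → M → CoveringUnitons.Cn n,
        (∀ i < r, ∀ j, CoveringUnitons.IsMeromorphic (H i j)) ∧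
          CoveringUnitons.GivenByArray z α r H,
      ∃ B : CoveringUnitons.Subbundle M (CoveringUnitons.Crn r n),
        B.IsHolomorphic ∧ CoveringUnitons.GivenByBundle z α r B] := by
  have key : CoveringUnitons.IsUnitonSequence φ₀ α r ∧ CoveringUnitons.Covering α r →
      ∃ H : Fin n → M → CoveringUnitons.Crn r n,
        (∀ j, (CoveringUnitons.kernelBundle α r).IsMeromorphicSection (H j)) ∧
        ∀ 𝓗 : Set (M → CoveringUnitons.Crn r n), (∀ j, H j ∈ 𝓗) →
          (∀ G ∈ 𝓗, (CoveringUnitons.kernelBundle α r).IsMeromorphicSection G) →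
            CoveringUnitons.IsGeneratedBy z α r 𝓗 := by
    rintro ⟨hu, hc⟩
    obtain ⟨r, rfl⟩ : ∃ k, r = k + 1 := ⟨r - 1, by omega⟩
    obtain ⟨H, hH, hspan⟩ := CoveringUnitons.exists_meromorphicSections hu
    exact ⟨H, hH, fun 𝓗 h1 h2 =>
      CoveringUnitons.isGeneratedBy_of_covering hz hu hc hspan h1 h2⟩
  tfae_have 1 → 2 := by
    intro h
    obtain ⟨H, hH, hg⟩ := key h
    have hmer : ∀ i < r, ∀ j,
        CoveringUnitons.IsMeromorphic ((fun i j => CoveringUnitons.comp (H j) i) i j) :=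
      fun i _ j => CoveringUnitons.isMeromorphic_comp (hH j).1 i
    refine ⟨fun i j => CoveringUnitons.comp (H j) i, hmer, ?_⟩
    rw [CoveringUnitons.givenByArray_iff hz hmer, CoveringUnitons.column_comp]
    exact hg _ (fun j => ⟨j, rfl⟩) (Set.forall_mem_range.2 hH)
  tfae_have 1 → 3 := by
    intro h
    obtain ⟨H, hH, hg⟩ := key h
    exact ⟨CoveringUnitons.kernelBundle α r, CoveringUnitons.isHolomorphic_kernelBundle h.1,
      CoveringUnitons.givenByBundle_iff.2 (hg _ hH fun _ hG => hG)⟩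
  tfae_have 2 → 1 := by
    rintro ⟨H, hH, hg⟩
    have hg' := (CoveringUnitons.givenByArray_iff hz hH).1 hg
    exact ⟨hg'.isUnitonSequence hz, hg'.covering⟩
  tfae_have 3 → 1 := by
    rintro ⟨B, -, hg⟩
    have hg' := CoveringUnitons.givenByBundle_iff.1 hg
    exact ⟨hg'.isUnitonSequence hz, hg'.covering⟩
  tfae_finish
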